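/- **Proposition (integral formula for the rate of escape).** There is a function $\delta\mapsto C_2=C_2(\delta)$ such that the following holds. Let $(X,d)$ be a proper geodesic metric space with base point $o$ which is $\delta$-hyperbolic, i.e. $(x|z)_w\ge\min\{(x|y)_w,(y|z)_w\}-\delta$ for all $x,y,z,w\in X$, where $(x|y)_w=\tfrac12[d(w,x)+d(w,y)-d(x,y)]$. Let $\partial X$ be its hyperbolic boundary: the set of geodesic rays $\sigma:[0,\infty[\to X$ modulo bounded distance, with the topology in which the sets $\{\eta:(\xi|\eta)>R\}$, $R>0$, are a base of neighbourhoods of $\xi$ (here $(\cdot|\cdot)$ is the Gromov product based at $o$, extended to $X\cup\partial X$ by the infimum of $\liminf_n(u_n|v_n)$ over sequences $u_n,v_n$ of points of $X$ tending to the two given points). A sequence $(y_n)$ in $X$ converges to $\xi\in\partial X$ if $(\xi|y_n)\to+\infty$. For a ray $\sigma$ put $f_\sigma(x)=\lim_{t\to\infty}\big(d(x,\sigma(t))-t\big)$ and $\beta_\sigma(x,y)=f_\sigma(y)-f_\sigma(x)$, and for $\xi\in\partial X$ let $\beta_\xi(x,y)=\sup_\sigma\beta_\sigma(x,y)$, the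 supremum over all rays $\sigma$ with endpoint $\xi$ (the Busemann quasi-cocycle). Let $G$ be a subgroup of the isometry group of $X$ and $\mu$ a (discrete) probability measure on $G$ with finite first moment, $\sum_g\mu(g)\,d(o,go)<\infty$. Let $x_n=h_1\cdots h_n$, where $(h_n)$ are independent $\mu$-distributed random variables, and suppose that $(x_no)$ converges almost surely to an element $x_\infty\in\partial X$. Then: 1. $x_\infty$ is almost everywhere equal to a Borel measurable map; let $\nu$ be its law. The convolution powers $\mu^n$ have finite first moment, and the rate of escape $$l(G,\mu)=\lim_{n\to\infty}\frac1n\sum_g\mu^n(g)\,d(o,go)$$ exists. Each function $\xi\mapsto\beta_\xi(o,g^{-1}o)$, $g\in G$, is $\nu$-integrable, and the series $\sum_g\mu(g)\int_{\partial X}\beta_\xi(o,g^{-1}o)\,d\nu(\xi)$ converges absolutely. 2. $$\Big|\,l(G,\mu)-\sum_g\mu(g)\int_{\partial X}\beta_\xi(o,g^{-1}o)\,d\nu(\xi)\Big|\le C_2 .$$ 3. If $X$ has property $(P)$: *for any two equivalent rays $\sigma_1,\sigma_2$ there is $T_0\in\mathbb R$ with $\lim_{t\to\infty}d(\sigma_1(t),\sigma_2(t+T_0))=0$*,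 then $$l(G,\mu)=\sum_g\mu(g)\int_{\partial X}\beta_\xi(o,g^{-1}o)\,d\nu(\xi).$$ 4. If $X$ is a CAT$(-1)$ space, then $X$ has property $(P)$; so the formula is exact in that case. -/

import Mathlib

open Filter Topology MeasureTheory ProbabilityTheory
open scoped NNReal ENNReal

universe u v

noncomputable section

namespace HypWalk

/-! ### Geodesic and hyperbolic metric spaces -/

/-- `X` is a geodesic space: any two points are the endpoints of a geodesic segment. -/
def IsGeodesicSpace (X : Type*) [MetricSpace X] : Prop :=
  ∀ x y : X, ∃ γ : ℝ → X, γ 0 = x ∧ γ (dist x y) = y ∧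
    ∀ s ∈ Set.Icc 0 (dist x y), ∀ t ∈ Set.Icc 0 (dist x y), dist (γ s) (γ t) = |s - t|

/-- The Gromov product `(x|y)_o`. -/
def gromovProduct {X : Type*} [MetricSpace X] (o x y : X) : ℝ :=
  (dist o x + dist o y - dist x y) / 2

/-- The `δ`-hyperbolicity inequality, for all base points. -/
def IsHyperbolic (X : Type*) [MetricSpace X] (δ : ℝ) : Prop :=
  ∀ x y z o : X,
    min (gromovProduct o x y) (gromovProduct o y z) - δ ≤ gromovProduct o x z

/-! ### Geodesic rays and the boundary -/

/-- A geodesic ray is an isometric map from `[0, ∞[` to `X`. -/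
def GeodesicRay (X : Type*) [MetricSpace X] : Type _ := {σ : ℝ≥0 → X // Isometry σ}

instance (X : Type*) [MetricSpace X] : CoeFun (GeodesicRay X) (fun _ => ℝ≥0 → X) :=
  ⟨fun σ => σ.1⟩

/-- Two rays are equivalent if they stay at bounded distance from each other. -/
def GeodesicRay.Equivalent {X : Type*} [MetricSpace X] (σ₁ σ₂ : GeodesicRay X) : Prop :=
  ∃ D : ℝ, ∀ t : ℝ≥0, dist (σ₁ t) (σ₂ t) ≤ D

/-- Equivalence of rays as a setoid. -/
def raySetoid (X : Type*) [MetricSpace X] : Setoid (GeodesicRay X) where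
  r := GeodesicRay.Equivalent
  iseqv :=
    { refl := fun σ => ⟨0, fun t => by simp⟩
      symm := by
        rintro σ τ ⟨D, hD⟩
        exact ⟨D, fun t => by rw [dist_comm]; exact hD t⟩
      trans := by
        rintro σ τ ρ ⟨D, hD⟩ ⟨E, hE⟩
        exact ⟨D + E, fun t => (dist_triangle _ (τ t) _).trans (add_le_add (hD t) (hE t))⟩ }

/-- The hyperbolic boundary of the pointed space `(X, o)`: equivalence classes of geodesic rays.
The base point plays no role in the underlying set (rays may start anywhere); it is recorded in
the type because the topology below is written with the Gromov product based at `o`. -/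
def Boundary {X : Type*} [MetricSpace X] (_o : X) : Type _ := Quotient (raySetoid X)

/-- The endpoint `σ(+∞)` of a ray. -/
def GeodesicRay.endpoint {X : Type*} [MetricSpace X] (o : X) (σ : GeodesicRay X) : Boundary o :=
  Quotient.mk (raySetoid X) σ

/-- A sequence of points of `X` represents a point of `X ∪ ∂X`: for a point of `X` this is
convergence in `X`; for a boundary point `ξ` it means that the Gromov products
`(u n | σ t)` tend to infinity as `n, t → ∞`, for the rays `σ` with endpoint `ξ`. -/
def Represents {X : Type*} [MetricSpace X] (o : X) (u : ℕ → X) : X ⊕ Boundary o → Prop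
  | Sum.inl x => Tendsto u atTop (𝓝 x)
  | Sum.inr ξ => ∀ σ : GeodesicRay X, σ.endpoint o = ξ →
      Tendsto (fun p : ℕ × ℝ≥0 => gromovProduct o (u p.1) (σ p.2)) (atTop ×ˢ atTop) atTop

/-- The Gromov product extended to `X ∪ ∂X`, with values in the extended reals: the infimum of
`liminf (u n | v n)` over all sequences representing the two points. -/
def extGromovProduct {X : Type*} [MetricSpace X] (o : X) (a b : X ⊕ Boundary o) : EReal :=
  ⨅ (u : ℕ → X) (v : ℕ → X) (_ : Represents o u a) (_ : Represents o v b),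
    liminf (fun n => ((gromovProduct o (u n) (v n) : ℝ) : EReal)) atTop

/-- Convergence of a sequence of points of `X` to a boundary point: `(ξ | x n) → +∞`. -/
def ConvergesTo {X : Type*} [MetricSpace X] (o : X) (x : ℕ → X) (ξ : Boundary o) : Prop :=
  Tendsto (fun n => extGromovProduct o (Sum.inr ξ) (Sum.inl (x n))) atTop (𝓝 ⊤)

/-- The topology of the boundary: the sets `{η | (ξ|η) > R}` are the basic neighbourhoods
of `ξ`. -/
instance {X : Type*} [MetricSpace X] (o : X) : TopologicalSpace (Boundary o) where
  IsOpen U := ∀ ξ ∈ U, ∃ R : ℝ, ∀ η : Boundary o,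
    (R : EReal) < extGromovProduct o (Sum.inr ξ) (Sum.inr η) → η ∈ U
  isOpen_univ := fun _ _ => ⟨0, fun _ _ => trivial⟩
  isOpen_inter := by
    rintro U V hU hV ξ ⟨hξU, hξV⟩
    obtain ⟨R, hR⟩ := hU ξ hξU
    obtain ⟨S, hS⟩ := hV ξ hξV
    refine ⟨max R S, fun η hη => ⟨hR η (lt_of_le_of_lt ?_ hη), hS η (lt_of_le_of_lt ?_ hη)⟩⟩
    · exact EReal.coe_le_coe_iff.2 (le_max_left R S)
    · exact EReal.coe_le_coe_iff.2 (le_max_right R S)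
  isOpen_sUnion := by
    rintro S hS ξ ⟨U, hU, hξ⟩
    obtain ⟨R, hR⟩ := hS U hU ξ hξ
    exact ⟨R, fun η hη => ⟨U, hU, hR η hη⟩⟩

/-- The Borel σ-algebra of the boundary. -/
instance {X : Type*} [MetricSpace X] (o : X) : MeasurableSpace (Boundary o) := borel _

instance {X : Type*} [MetricSpace X] (o : X) : BorelSpace (Boundary o) := ⟨rfl⟩

/-! ### Busemann functions -/

/-- The Busemann function `f_σ(x) = lim (d(x, σ t) - t)`. -/
def busemannFun {X : Type*} [MetricSpace X] (σ : GeodesicRay X) (x : X) : ℝ :=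
  limUnder atTop (fun t : ℝ≥0 => dist x (σ t) - (t : ℝ))

/-- `β_σ(x, y) = f_σ(y) - f_σ(x)`. -/
def busemannRay {X : Type*} [MetricSpace X] (σ : GeodesicRay X) (x y : X) : ℝ :=
  busemannFun σ y - busemannFun σ x

/-- The Busemann quasi-cocycle `β_ξ(x, y)`: the supremum of `β_σ(x, y)` over all rays `σ` with
endpoint `ξ`. -/
def busemann {X : Type*} [MetricSpace X] {o : X} (ξ : Boundary o) (x y : X) : ℝ :=
  ⨆ σ : {σ : GeodesicRay X // σ.endpoint o = ξ}, busemannRay σ.1 x y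

/-- Property (P): two equivalent rays are asymptotic up to a shift of the parameter. -/
def PropertyP (X : Type*) [MetricSpace X] : Prop :=
  ∀ σ₁ σ₂ : GeodesicRay X, σ₁.Equivalent σ₂ → ∃ T₀ : ℝ,
    Tendsto (fun t : ℝ => dist (σ₁ t.toNNReal) (σ₂ (t + T₀).toNNReal)) atTop (𝓝 0)

/-- `X` is a CAT(-1) space: it is geodesic, and distances between points on two sides of a
geodesic triangle are at most those between the corresponding points of a comparison triangle
in the hyperbolic plane. (In a geodesic space, the points of the geodesic segments from `p`
to `q` are those with `d(p,x) + d(x,q) = d(p,q)`.) -/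
def IsCATNegOne (X : Type*) [MetricSpace X] : Prop :=
  IsGeodesicSpace X ∧
  ∀ p q r x y : X, dist p x + dist x q = dist p q → dist p y + dist y r = dist p r →
    ∀ p' q' r' x' y' : UpperHalfPlane,
      dist p' q' = dist p q → dist p' r' = dist p r → dist q' r' = dist q r →
      dist p' x' = dist p x → dist x' q' = dist x q →
      dist p' y' = dist p y → dist y' r' = dist y r →
      dist x y ≤ dist x' y'

/-! ### Random walks -/

/-- The position `x_n = h_1 ⋯ h_n` of the random walk with increments `h` (indexed from `0`). -/
def walk {G Ω : Type*} [Group G] (h : ℕ → Ω → G) : ℕ → Ω → G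
  | 0, _ => 1
  | n + 1, ω => walk h n ω * h n ω

/-- The convolution powers of a probability on a group. -/
def convPow {G : Type*} [Group G] (μ : PMF G) : ℕ → PMF G
  | 0 => PMF.pure 1
  | n + 1 => (convPow μ n).bind fun g => μ.map fun h => g * h

variable {X : Type*} [MetricSpace X]

/-- `μ` has a finite first moment: `∑ μ(g) d(o, g o) < ∞`. -/
def HasFiniteFirstMoment {G : Subgroup (X ≃ᵢ X)} (o : X) (μ : PMF G) : Prop :=
  Summable fun g : G => (μ g).toReal * dist o (g.1 o)

/-- `L(μ) = ∑ μ(g) d(o, g o)`. -/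
def firstMoment {G : Subgroup (X ≃ᵢ X)} (o : X) (μ : PMF G) : ℝ :=
  ∑' g : G, (μ g).toReal * dist o (g.1 o)

/-- The rate of escape `l(G, μ) = lim L(μ^n) / n`. -/
def rateOfEscape {G : Subgroup (X ≃ᵢ X)} (o : X) (μ : PMF G) : ℝ :=
  limUnder atTop (fun n : ℕ => firstMoment o (convPow μ n) / n)

/-- The sum `∑ μ(g) ∫ β_ξ(o, g⁻¹ o) dν(ξ)`. -/
def busemannDrift {G : Subgroup (X ≃ᵢ X)} (o : X) (μ : PMF G) (ν : Measure (Boundary o)) : ℝ :=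
  ∑' g : G, (μ g).toReal * ∫ ξ, busemann ξ o (g⁻¹.1 o) ∂ν

end HypWalk

end

open HypWalk

/-! Let C bound β_σ(x,y) - β_τ(x,y) over all equivalent rays σ, τ. Hyperbolicity gives C = 2δ
(`IsHyperbolic.busemannRay_le`) and property (P) gives C = 0 (`PropertyP.busemannRay_le`), so one
argument with C as a parameter yields both formulas.

If x_k → ξ, then d(y,x_k) - d(o,x_k) is eventually within C + ε of β_ξ(o,y)
(`ConvergesTo.eventually_abs_le`): geodesics from o and from y to x_k subconverge to rays ending at
ξ, and each of the two rays controls one side. Write L for the first moment. Splitting off the first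
increment g gives L(μ^{n+1}) - L(μ^n) = Σ μ(g) E[d(g⁻¹o, x_n o) - d(o, x_n o)]
(`hasSum_firstMoment_sub`). The integrands are bounded by d(o,go), so by dominated convergence this
increment is within C + b_n of the drift, with b_n → 0. Telescoping and Cesàro averaging give the
bound C (`abs_rateOfEscape_sub_busemannDrift_le`).

For measurability, x_∞ is the limit of near-projections of x_n o to the boundary, which is
pseudometrizable (`aemeasurable_of_convergesTo`), and ξ ↦ β_ξ(o,y) is upper semicontinuous
(`upperSemicontinuous_busemann`).

In a CAT(-1) space, shifting one of two equivalent rays so that their Busemann levels agree makes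
them asymptotic, by comparing two thin triangles with hyperbolic ones (`IsCATNegOne.propertyP`). -/

namespace HypWalk

/-! ### Rays, their Busemann functions, and limits of geodesics. -/

section Geometry

variable {X : Type*} [MetricSpace X]

/-! ### Busemann functions of rays -/

lemma GeodesicRay.dist_eq (σ : GeodesicRay X) (s t : ℝ≥0) :
    dist (σ s) (σ t) = |(s : ℝ) - t| := by
  rw [σ.2.dist_eq, NNReal.dist_eq]

lemma antitone_dist_sub (σ : GeodesicRay X) (x : X) :
    Antitone (fun t : ℝ≥0 => dist x (σ t) - (t : ℝ)) := by
  intro s t hst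
  have h1 := dist_triangle x (σ s) (σ t)
  have h2 : (s : ℝ) ≤ t := hst
  rw [σ.dist_eq, abs_of_nonpos (by linarith)] at h1
  show dist x (σ t) - (t : ℝ) ≤ dist x (σ s) - s
  linarith

lemma neg_dist_le_dist_sub (σ : GeodesicRay X) (x : X) (t : ℝ≥0) :
    -dist x (σ 0) ≤ dist x (σ t) - (t : ℝ) := by
  have h1 := dist_triangle (σ 0) x (σ t)
  rw [σ.dist_eq, dist_comm (σ 0) x, abs_of_nonpos (by simp)] at h1
  simp only [NNReal.coe_zero] at h1
  linarith

lemma tendsto_busemannFun (σ : GeodesicRay X) (x : X) :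
    Tendsto (fun t : ℝ≥0 => dist x (σ t) - (t : ℝ)) atTop (𝓝 (busemannFun σ x)) := by
  refine tendsto_nhds_limUnder ⟨_, tendsto_atTop_ciInf (antitone_dist_sub σ x) ?_⟩
  refine ⟨-dist x (σ 0), ?_⟩
  rintro _ ⟨t, rfl⟩
  exact neg_dist_le_dist_sub σ x t

lemma busemannFun_le (σ : GeodesicRay X) (x : X) (t : ℝ≥0) :
    busemannFun σ x ≤ dist x (σ t) - t :=
  (antitone_dist_sub σ x).le_of_tendsto (tendsto_busemannFun σ x) t

lemma le_busemannFun (σ : GeodesicRay X) (x : X) {c : ℝ}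
    (h : ∀ t : ℝ≥0, c ≤ dist x (σ t) - t) : c ≤ busemannFun σ x :=
  ge_of_tendsto' (tendsto_busemannFun σ x) h

lemma busemannFun_apply (σ : GeodesicRay X) (t : ℝ≥0) : busemannFun σ (σ t) = -t := by
  refine tendsto_nhds_unique (tendsto_busemannFun σ (σ t)) (tendsto_const_nhds.congr' ?_)
  filter_upwards [eventually_ge_atTop t] with s hs
  have h2 : (t : ℝ) ≤ s := hs
  rw [σ.dist_eq, abs_of_nonpos (by linarith)]
  ring

lemma busemannFun_le_add_dist (σ : GeodesicRay X) (x y : X) :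
    busemannFun σ x ≤ busemannFun σ y + dist x y := by
  refine le_of_tendsto_of_tendsto' (tendsto_busemannFun σ x)
    ((tendsto_busemannFun σ y).add_const _) fun t => ?_
  have := dist_triangle x y (σ t)
  linarith

lemma abs_busemannRay_le (σ : GeodesicRay X) (x y : X) : |busemannRay σ x y| ≤ dist x y := by
  have h1 := busemannFun_le_add_dist σ x y
  have h2 := busemannFun_le_add_dist σ y x
  rw [dist_comm y x] at h2
  rw [busemannRay, abs_le]
  constructor <;> linarith

lemma tendsto_busemannRay (σ : GeodesicRay X) (x y : X) :
    Tendsto (fun t : ℝ≥0 => dist y (σ t) - dist x (σ t)) atTop (𝓝 (busemannRay σ x y)) := by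
  refine ((tendsto_busemannFun σ y).sub (tendsto_busemannFun σ x)).congr fun t => ?_
  ring

lemma busemannRay_antisymm (σ : GeodesicRay X) (x y : X) :
    busemannRay σ x y = -busemannRay σ y x := by
  simp [busemannRay]

/-! ### Gromov products along rays -/

lemma gromovProduct_comm (o x y : X) : gromovProduct o x y = gromovProduct o y x := by
  rw [gromovProduct, gromovProduct, dist_comm x y]
  ring

lemma gromovProduct_le_left (o x y : X) : gromovProduct o x y ≤ dist o x := by
  have := dist_triangle o x y
  rw [gromovProduct]
  linarith

lemma gromovProduct_le_add_dist (o p x y : X) :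
    gromovProduct p x y ≤ gromovProduct o x y + dist o p := by
  have h1 := dist_triangle p o x
  have h2 := dist_triangle p o y
  rw [dist_comm p o] at h1 h2
  rw [gromovProduct, gromovProduct]
  linarith

lemma dist_ray_le (o : X) (σ : GeodesicRay X) (t : ℝ≥0) : dist o (σ t) ≤ t + dist o (σ 0) := by
  have h1 := dist_triangle o (σ 0) (σ t)
  rw [σ.dist_eq, abs_of_nonpos (by simp)] at h1
  simp only [NNReal.coe_zero] at h1
  linarith

lemma GeodesicRay.Equivalent.refl (σ : GeodesicRay X) : σ.Equivalent σ := (raySetoid X).refl σ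

lemma GeodesicRay.Equivalent.symm {σ τ : GeodesicRay X} (h : σ.Equivalent τ) : τ.Equivalent σ :=
  (raySetoid X).symm h

lemma GeodesicRay.Equivalent.exists_le_gromovProduct (o : X) {σ τ : GeodesicRay X}
    (h : σ.Equivalent τ) :
    ∃ D : ℝ, ∀ s t : ℝ≥0, min (s : ℝ) t - D ≤ gromovProduct o (σ s) (τ t) := by
  obtain ⟨D, hD⟩ := h
  refine ⟨(dist o (σ 0) + dist o (τ 0) + D) / 2, fun s t => ?_⟩
  have h1 := neg_dist_le_dist_sub σ o s
  have h2 := neg_dist_le_dist_sub τ o t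
  have h3 := (dist_triangle (σ s) (σ t) (τ t)).trans (add_le_add le_rfl (hD t))
  rw [σ.dist_eq] at h3
  rw [gromovProduct]
  rcases le_total (s : ℝ) t with hst | hst
  · rw [min_eq_left hst]
    rw [abs_of_nonpos (by linarith)] at h3
    linarith
  · rw [min_eq_right hst]
    rw [abs_of_nonneg (by linarith)] at h3
    linarith

lemma equivalent_of_le_gromovProduct {o : X} {σ τ : GeodesicRay X} {K : ℝ}
    (h : ∀ s : ℝ≥0, (s : ℝ) - K ≤ gromovProduct o (σ s) (τ s)) : σ.Equivalent τ := by
  refine ⟨dist o (σ 0) + dist o (τ 0) + 2 * K, fun s => ?_⟩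
  have h1 := dist_ray_le o σ s
  have h2 := dist_ray_le o τ s
  have h3 := h s
  rw [gromovProduct] at h3
  linarith

/-- Far out on the rays (τ t|σ t)_x exceeds d(x,y) ≥ (y|τ t)_x, so the minimum in the hyperbolicity
inequality is (y|τ t)_x. Clearing the factor 1/2 in the Gromov products turns δ into 2δ. -/
lemma IsHyperbolic.busemannRay_le {δ : ℝ} (hδ : IsHyperbolic X δ) {σ τ : GeodesicRay X}
    (h : σ.Equivalent τ) (x y : X) : busemannRay σ x y ≤ busemannRay τ x y + 2 * δ := by
  obtain ⟨D, hD⟩ := h.symm.exists_le_gromovProduct x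
  refine le_of_tendsto_of_tendsto (tendsto_busemannRay σ x y)
    ((tendsto_busemannRay τ x y).add_const _) ?_
  filter_upwards [NNReal.tendsto_coe_atTop.2 tendsto_id |>.eventually_ge_atTop (dist x y + D)]
    with t ht
  have h1 := hδ y (τ t) (σ t) x
  have h2 := hD t t
  have h3 := gromovProduct_le_left x y (τ t)
  simp only [min_self, id] at h2 ht
  rw [min_eq_left (by linarith)] at h1
  simp only [gromovProduct] at h1
  linarith

/-- The parameter shift is harmless because d(y,τ t) - d(x,τ t) does not involve t explicitly. The
`+ 0` matches the form of the bound with constant C used later. -/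
lemma PropertyP.busemannRay_le (hP : PropertyP X) {σ τ : GeodesicRay X}
    (h : σ.Equivalent τ) (x y : X) : busemannRay σ x y ≤ busemannRay τ x y + 0 := by
  obtain ⟨T, hT⟩ := hP σ τ h
  have h1 := (tendsto_busemannRay σ x y).comp tendsto_real_toNNReal_atTop
  have h2 := (tendsto_busemannRay τ x y).comp
    (tendsto_real_toNNReal_atTop.comp (tendsto_atTop_add_const_right atTop T tendsto_id))
  rw [← mul_zero 2]
  refine le_of_tendsto_of_tendsto' h1 (h2.add (hT.const_mul 2)) fun t => ?_
  simp only [Function.comp_apply, id]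
  have h3 := dist_triangle y (τ (t + T).toNNReal) (σ t.toNNReal)
  have h4 := dist_triangle x (σ t.toNNReal) (τ (t + T).toNNReal)
  rw [dist_comm (τ _)] at h3
  linarith

/-! ### Limits of geodesics -/

/-- Ultrafilter limits replace Arzelà–Ascoli: each `γ i t` stays in a compact ball around `p`. The
isometry condition is only eventual in `i`, so that geodesic segments of growing length are allowed.
The hypothesis `hK` makes the limit ray equivalent to `τ`. -/
lemma exists_limit_ray [ProperSpace X] {δ : ℝ} (hδ : IsHyperbolic X δ) {o : X} {ι : Type*}
    (U : Ultrafilter ι) (γ : ι → ℝ≥0 → X) (p : X) (h0 : ∀ᶠ i in (U : Filter ι), γ i 0 = p)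
    (hγ : ∀ s t : ℝ≥0, ∀ᶠ i in (U : Filter ι), dist (γ i s) (γ i t) = |(s : ℝ) - t|)
    (τ : GeodesicRay X) (K : ℝ)
    (hK : ∀ s : ℝ≥0, ∀ᶠ i in (U : Filter ι), ∃ t : ℝ≥0, s ≤ t ∧
      (s : ℝ) - K ≤ gromovProduct o (γ i s) (τ t)) :
    ∃ σ : GeodesicRay X, σ 0 = p ∧ σ.Equivalent τ ∧
      ∀ t, Tendsto (fun i => γ i t) U (𝓝 (σ t)) := by
  have hlim : ∀ t : ℝ≥0, ∃ x, Tendsto (fun i => γ i t) U (𝓝 x) := by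
    intro t
    have hmem : ∀ᶠ i in (U : Filter ι), γ i t ∈ Metric.closedBall p t := by
      filter_upwards [h0, hγ t 0] with i hi ht
      rw [Metric.mem_closedBall, ← hi, ht]
      simp
    obtain ⟨x, -, hx⟩ := (isCompact_closedBall p (t : ℝ)).ultrafilter_le_nhds
      (U.map fun i => γ i t) (tendsto_principal.2 hmem)
    exact ⟨x, hx⟩
  choose σ hσ using hlim
  have hiso : Isometry σ := by
    refine Isometry.of_dist_eq fun s t => ?_
    rw [NNReal.dist_eq]
    exact tendsto_nhds_unique ((hσ s).dist (hσ t))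
      (tendsto_const_nhds.congr' ((hγ s t).mono fun i hi => hi.symm))
  refine ⟨⟨σ, hiso⟩, ?_, ?_, hσ⟩
  · exact tendsto_nhds_unique (hσ 0) (tendsto_const_nhds.congr' (h0.mono fun i hi => hi.symm))
  · obtain ⟨D, hD⟩ := (GeodesicRay.Equivalent.refl τ).exists_le_gromovProduct o
    -- The points `τ t` and `τ s` are compared through `D`; one use of hyperbolicity costs the extra
    -- `δ`.
    refine equivalent_of_le_gromovProduct (o := o) (K := max K D + δ) fun s => ?_
    have hlim : Tendsto (fun i => gromovProduct o (γ i s) (τ s)) U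
        (𝓝 (gromovProduct o (σ s) (τ s))) := by
      unfold gromovProduct
      exact (((tendsto_const_nhds.dist (hσ s)).add tendsto_const_nhds).sub
        ((hσ s).dist tendsto_const_nhds)).div_const 2
    refine ge_of_tendsto hlim ?_
    filter_upwards [hK s] with i ⟨t, hst, ht⟩
    have h1 := hδ (γ i s) (τ t) (τ s) o
    have h2 := hD t s
    rw [min_eq_right (by exact_mod_cast hst)] at h2
    refine le_trans ?_ h1
    rw [← sub_sub]
    refine sub_le_sub_right (le_min ?_ ?_) _
    · exact le_trans (by linarith [le_max_left K D]) ht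
    · exact le_trans (by linarith [le_max_right K D]) h2

/-- The points `x i` tend to the endpoint of the ray `τ` along the filter `l`. -/
def TendsToEnd (o : X) {ι : Type*} (l : Filter ι) (x : ι → X) (τ : GeodesicRay X) : Prop :=
  ∀ R : ℝ, ∀ᶠ i in l, ∃ t : ℝ≥0, R ≤ t ∧ R ≤ gromovProduct o (x i) (τ t)

lemma tendsToEnd_self (o : X) (τ : GeodesicRay X) : TendsToEnd o atTop (fun t => τ t) τ := by
  obtain ⟨D, hD⟩ := (GeodesicRay.Equivalent.refl τ).exists_le_gromovProduct o
  intro R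
  filter_upwards [NNReal.tendsto_coe_atTop.2 tendsto_id |>.eventually_ge_atTop R,
    NNReal.tendsto_coe_atTop.2 tendsto_id |>.eventually_ge_atTop (R + D)] with t ht ht'
  refine ⟨t, ht, le_trans ?_ (hD t t)⟩
  simp only [min_self, id] at ht' ⊢
  linarith

/-- σ is the limit of geodesics c_i from p to x_i. Passing through c_i(t) gives d(y,x_i) - d(p,x_i)
≤ d(y,c_i(t)) - t, and the right side is close to f_σ(y) for t large. Only this upper bound is
available; the lower one comes from exchanging p and y. -/
lemma exists_ray_of_tendsToEnd [ProperSpace X] (hX : IsGeodesicSpace X) {δ : ℝ}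
    (hδ : IsHyperbolic X δ) {o : X} {ι : Type*} (U : Ultrafilter ι) {x : ι → X}
    {τ : GeodesicRay X} (hx : TendsToEnd o U x τ) (p : X) :
    ∃ σ : GeodesicRay X, σ 0 = p ∧ σ.Equivalent τ ∧ ∀ y, ∀ ε > 0,
      ∀ᶠ i in (U : Filter ι), dist y (x i) - dist p (x i) ≤ busemannRay σ p y + ε := by
  choose c hc0 hc1 hc using fun i => hX p (x i)
  have hfar : ∀ R : ℝ, ∀ᶠ i in (U : Filter ι), R ≤ dist p (x i) := by
    intro R
    filter_upwards [hx (R + dist o p)] with i ⟨t, _, ht⟩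
    have h1 := gromovProduct_le_left o (x i) (τ t)
    have h2 := dist_triangle o p (x i)
    linarith
  have hγ : ∀ s t : ℝ≥0, ∀ᶠ i in (U : Filter ι), dist (c i s) (c i t) = |(s : ℝ) - t| := by
    intro s t
    filter_upwards [hfar s, hfar t] with i hs ht
    exact hc i s ⟨s.2, hs⟩ t ⟨t.2, ht⟩
  have hdist : ∀ s : ℝ≥0, ∀ᶠ i in (U : Filter ι), dist (c i s) (x i) = dist p (x i) - s := by
    intro s
    filter_upwards [hfar s] with i hs
    have h1 := hc i s ⟨s.2, hs⟩ (dist p (x i)) ⟨dist_nonneg, le_rfl⟩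
    rwa [hc1, abs_of_nonpos (by linarith), neg_sub] at h1
  -- In the constant, `dist o p` pays for moving the base point from `p` to `o`, and `δ` for passing
  -- from `x i` to `τ t`.
  obtain ⟨σ, hσ0, hστ, hσ⟩ := exists_limit_ray hδ (o := o) U (fun i s => c i s) p
    (Eventually.of_forall fun i => hc0 i) hγ τ (dist o p + δ) (by
      intro s
      filter_upwards [hx s, hdist s, hγ 0 s] with i ⟨t, hst, ht⟩ hs hs0
      refine ⟨t, by exact_mod_cast hst, ?_⟩
      have h1 := hδ (c i s) (x i) (τ t) o
      have h2 := gromovProduct_le_add_dist o p (c i s) (x i)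
      rw [NNReal.coe_zero, hc0, zero_sub, abs_neg, NNReal.abs_eq] at hs0
      have h3 : gromovProduct p (c i s) (x i) = s := by
        rw [gromovProduct, hs, hs0]
        ring
      refine le_trans ?_ h1
      rw [← sub_sub]
      refine sub_le_sub_right (le_min ?_ ?_) _
      · linarith
      · linarith [dist_nonneg (x := o) (y := p)])
  refine ⟨σ, hσ0, hστ, fun y ε hε => ?_⟩
  obtain ⟨t, ht⟩ := ((tendsto_busemannFun σ y).eventually_lt_const
    (show busemannFun σ y < busemannFun σ y + ε / 2 by linarith)).exists
  have hp : busemannFun σ p = 0 := by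
    rw [← hσ0, busemannFun_apply]
    simp
  have h1 := ((tendsto_const_nhds (x := y)).dist (hσ t)).eventually_lt_const
    (show dist y (σ t) < dist y (σ t) + ε / 2 by linarith)
  filter_upwards [h1, hdist t] with i hi hd
  have h2 := dist_triangle y (c i t) (x i)
  rw [busemannRay, hp]
  linarith

/-- With x_i running along τ itself, the previous bound shows that the supremum defining β_ξ(p,y)
may be taken over rays issuing from p, where compactness applies. -/
lemma exists_ray_from_busemannRay_le [ProperSpace X] (hX : IsGeodesicSpace X) {δ : ℝ}
    (hδ : IsHyperbolic X δ) (τ : GeodesicRay X) (p y : X) :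
    ∃ σ : GeodesicRay X, σ 0 = p ∧ σ.Equivalent τ ∧ busemannRay τ p y ≤ busemannRay σ p y := by
  obtain ⟨σ, h0, h1, h2⟩ := exists_ray_of_tendsToEnd hX hδ (o := p) (Ultrafilter.of atTop)
    (fun R => Ultrafilter.of_le _ (tendsToEnd_self p τ R)) p
  refine ⟨σ, h0, h1, le_of_forall_pos_le_add fun ε hε => ?_⟩
  exact le_of_tendsto ((tendsto_busemannRay τ p y).mono_left (Ultrafilter.of_le _)) (h2 y ε hε)

end Geometry

/-! ### The quasi-cocycle, the topology of the boundary, and measurability. -/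

section Boundary

variable {X : Type*} [MetricSpace X]

/-! ### The Busemann quasi-cocycle -/

lemma equivalent_of_endpoint_eq {o : X} {σ τ : GeodesicRay X} (h : σ.endpoint o = τ.endpoint o) :
    σ.Equivalent τ := Quotient.exact h

lemma GeodesicRay.Equivalent.endpoint_eq (o : X) {σ τ : GeodesicRay X} (h : σ.Equivalent τ) :
    σ.endpoint o = τ.endpoint o := Quotient.sound h

lemma exists_endpoint_eq {o : X} (ξ : Boundary o) : ∃ σ : GeodesicRay X, σ.endpoint o = ξ :=
  Quotient.exists_rep ξ

lemma busemannRay_le_busemann {o : X} (ξ : Boundary o) {σ : GeodesicRay X}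
    (hσ : σ.endpoint o = ξ) (x y : X) : busemannRay σ x y ≤ busemann ξ x y := by
  refine le_ciSup (f := fun σ : {σ : GeodesicRay X // σ.endpoint o = ξ} => busemannRay σ.1 x y)
    ⟨dist x y, ?_⟩ ⟨σ, hσ⟩
  rintro _ ⟨σ, rfl⟩
  exact (abs_le.1 (abs_busemannRay_le σ.1 x y)).2

lemma busemann_le {o : X} (ξ : Boundary o) {x y : X} {c : ℝ}
    (h : ∀ σ : GeodesicRay X, σ.endpoint o = ξ → busemannRay σ x y ≤ c) : busemann ξ x y ≤ c := by
  obtain ⟨σ, hσ⟩ := exists_endpoint_eq ξ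
  have : Nonempty {σ : GeodesicRay X // σ.endpoint o = ξ} := ⟨⟨σ, hσ⟩⟩
  exact ciSup_le fun σ => h σ.1 σ.2

lemma abs_busemann_le {o : X} (ξ : Boundary o) (x y : X) : |busemann ξ x y| ≤ dist x y := by
  obtain ⟨σ, hσ⟩ := exists_endpoint_eq ξ
  refine abs_le.2 ⟨?_, busemann_le ξ fun τ _ => (abs_le.1 (abs_busemannRay_le τ x y)).2⟩
  exact (abs_le.1 (abs_busemannRay_le σ x y)).1.trans (busemannRay_le_busemann ξ hσ x y)

/-! ### The extended Gromov product -/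

lemma eventually_lt_gromovProduct {o : X} {a b : X ⊕ Boundary o} {R : ℝ}
    (h : (R : EReal) < extGromovProduct o a b) {u v : ℕ → X} (hu : Represents o u a)
    (hv : Represents o v b) : ∀ᶠ n in atTop, R < gromovProduct o (u n) (v n) := by
  have h1 : extGromovProduct o a b ≤
      liminf (fun n => ((gromovProduct o (u n) (v n) : ℝ) : EReal)) atTop :=
    iInf_le_of_le u (iInf_le_of_le v (iInf_le_of_le hu (iInf_le_of_le hv le_rfl)))
  exact (eventually_lt_of_lt_liminf (h.trans_le h1)).mono fun n hn => EReal.coe_lt_coe_iff.1 hn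

lemma le_extGromovProduct {o : X} {a b : X ⊕ Boundary o} {R : ℝ}
    (h : ∀ u v : ℕ → X, Represents o u a → Represents o v b →
      ∀ᶠ n in atTop, R ≤ gromovProduct o (u n) (v n)) :
    (R : EReal) ≤ extGromovProduct o a b :=
  le_iInf fun u => le_iInf fun v => le_iInf fun hu => le_iInf fun hv =>
    le_liminf_of_le (by isBoundedDefault)
      ((h u v hu hv).mono fun _ hn => EReal.coe_le_coe_iff.2 hn)

lemma represents_const (o x : X) : Represents o (fun _ => x) (Sum.inl x) := tendsto_const_nhds

lemma represents_ray (o : X) (τ : GeodesicRay X) :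
    Represents o (fun n : ℕ => τ n) (Sum.inr (τ.endpoint o)) := by
  intro σ hσ
  obtain ⟨D, hD⟩ := (equivalent_of_endpoint_eq hσ).symm.exists_le_gromovProduct o
  refine tendsto_atTop_mono (fun p => hD p.1 p.2) (tendsto_atTop_add_const_right _ _ ?_)
  refine tendsto_atTop.2 fun R => ?_
  have h1 : ∀ᶠ n : ℕ in atTop, R ≤ ((n : ℝ≥0) : ℝ) := by
    simpa using tendsto_natCast_atTop_atTop.eventually_ge_atTop R
  have h2 : ∀ᶠ t : ℝ≥0 in atTop, R ≤ (t : ℝ) :=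
    (NNReal.tendsto_coe_atTop.2 tendsto_id).eventually_ge_atTop R
  filter_upwards [h1.prod_mk h2] with p hp
  exact le_min hp.1 hp.2

lemma exists_represents {o : X} (a : X ⊕ Boundary o) : ∃ u, Represents o u a := by
  rcases a with x | ξ
  · exact ⟨_, represents_const o x⟩
  · obtain ⟨σ, rfl⟩ := exists_endpoint_eq ξ
    exact ⟨_, represents_ray o σ⟩

lemma extGromovProduct_comm {o : X} (a b : X ⊕ Boundary o) :
    extGromovProduct o a b = extGromovProduct o b a := by
  unfold extGromovProduct
  rw [iInf_comm]
  refine iInf_congr fun u => iInf_congr fun v => ?_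
  rw [iInf_comm]
  simp_rw [gromovProduct_comm o (v _)]

lemma extGromovProduct_triangle {δ : ℝ} (hδ : IsHyperbolic X δ) {o : X} {a b c : X ⊕ Boundary o}
    {R : ℝ} (h1 : (R : EReal) < extGromovProduct o a b)
    (h2 : (R : EReal) < extGromovProduct o b c) :
    ((R - δ : ℝ) : EReal) ≤ extGromovProduct o a c := by
  obtain ⟨w, hw⟩ := exists_represents b
  refine le_extGromovProduct fun u v hu hv => ?_
  filter_upwards [eventually_lt_gromovProduct h1 hu hw,
    eventually_lt_gromovProduct h2 hw hv] with n hn1 hn2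
  exact le_trans (sub_le_sub_right (le_min hn1.le hn2.le) _) (hδ _ _ _ _)

lemma lt_extGromovProduct_self {δ : ℝ} (hδ : IsHyperbolic X δ) {o : X} (ξ : Boundary o) (R : ℝ) :
    (R : EReal) < extGromovProduct o (Sum.inr ξ) (Sum.inr ξ) := by
  obtain ⟨σ, hσ⟩ := exists_endpoint_eq ξ
  refine lt_of_lt_of_le (EReal.coe_lt_coe_iff.2 (lt_add_one R))
    (le_extGromovProduct fun u v hu hv => ?_)
  have hdiag : Tendsto (fun n : ℕ => (n, (n : ℝ≥0))) atTop (atTop ×ˢ atTop) :=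
    tendsto_id.prodMk tendsto_natCast_atTop_atTop
  filter_upwards [((hu σ hσ).comp hdiag).eventually_ge_atTop (R + 1 + δ),
    ((hv σ hσ).comp hdiag).eventually_ge_atTop (R + 1 + δ)] with n hn1 hn2
  have h := hδ (u n) (σ n) (v n) o
  rw [gromovProduct_comm o (σ n)] at h
  refine le_trans ?_ h
  rw [le_sub_iff_add_le]
  exact le_min hn1 hn2

lemma lt_dist_of_lt_extGromovProduct {o : X} {ξ : Boundary o} {x : X} {R : ℝ}
    (h : (R : EReal) < extGromovProduct o (Sum.inr ξ) (Sum.inl x)) : R < dist o x := by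
  obtain ⟨u, hu⟩ := exists_represents (Sum.inr ξ : X ⊕ Boundary o)
  obtain ⟨n, hn⟩ := (eventually_lt_gromovProduct h hu (represents_const o x)).exists
  rw [gromovProduct_comm] at hn
  exact hn.trans_le (gromovProduct_le_left _ _ _)

lemma ConvergesTo.eventually_lt {o : X} {x : ℕ → X} {ξ : Boundary o} (h : ConvergesTo o x ξ)
    (R : ℝ) : ∀ᶠ n in atTop, (R : EReal) < extGromovProduct o (Sum.inr ξ) (Sum.inl (x n)) :=
  Tendsto.eventually_const_lt (EReal.coe_lt_top R) h

lemma ConvergesTo.tendsToEnd {o : X} {x : ℕ → X} {τ : GeodesicRay X}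
    (h : ConvergesTo o x (τ.endpoint o)) : TendsToEnd o atTop x τ := by
  intro R
  filter_upwards [h.eventually_lt R] with n hn
  obtain ⟨j, hj, hjR⟩ := ((eventually_lt_gromovProduct hn (represents_ray o τ)
    (represents_const o (x n))).and (tendsto_natCast_atTop_atTop.eventually_ge_atTop R)).exists
  refine ⟨j, by simpa using hjR, ?_⟩
  rw [gromovProduct_comm]
  exact hj.le

/-! ### Horofunctions of sequences converging to the boundary -/

/-- The ray from o gives the upper bound β_ξ(o,y) + ε, since β_ξ is a supremum. The ray from y gives
the lower bound, and there C is lost in comparing that ray with the supremum. -/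
lemma ConvergesTo.eventually_abs_le [ProperSpace X] (hX : IsGeodesicSpace X) {δ : ℝ}
    (hδ : IsHyperbolic X δ) {C : ℝ}
    (hC : ∀ σ τ : GeodesicRay X, σ.Equivalent τ → ∀ x y : X,
      busemannRay σ x y ≤ busemannRay τ x y + C)
    {o : X} {x : ℕ → X} {ξ : Boundary o} (h : ConvergesTo o x ξ) (y : X) {ε : ℝ} (hε : 0 < ε) :
    ∀ᶠ k in atTop, |dist y (x k) - dist o (x k) - busemann ξ o y| ≤ C + ε := by
  obtain ⟨τ, rfl⟩ := exists_endpoint_eq ξ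
  refine mem_iff_ultrafilter.2 fun U hU => ?_
  have hx : TendsToEnd o U x τ := fun R => hU (h.tendsToEnd R)
  have hC0 : 0 ≤ C := by
    have := hC τ τ (GeodesicRay.Equivalent.refl τ) o o
    linarith
  obtain ⟨σ, -, hσ, hσy⟩ := exists_ray_of_tendsToEnd hX hδ U hx o
  obtain ⟨σ', -, hσ', hσy'⟩ := exists_ray_of_tendsToEnd hX hδ U hx y
  filter_upwards [hσy y ε hε, hσy' o ε hε] with k h1 h2
  have h3 := busemannRay_le_busemann _ (hσ.endpoint_eq o) o y
  have h4 : busemann (τ.endpoint o) o y ≤ busemannRay σ' o y + C :=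
    busemann_le _ fun ρ hρ => hC _ _ (equivalent_of_endpoint_eq (hρ.trans (hσ'.endpoint_eq o).symm)) _ _
  rw [busemannRay_antisymm] at h2
  rw [abs_le]
  constructor <;> linarith

/-! ### The topology of the boundary -/

/-- The uniform structure on the boundary defined by the extended Gromov product. -/
@[reducible]
def boundaryUniformSpace {δ : ℝ} (hδ : IsHyperbolic X δ) (o : X) : UniformSpace (Boundary o) :=
  .ofCore
    { uniformity := ⨅ n : ℕ, 𝓟 {p : Boundary o × Boundary o |
        ((n : ℝ) : EReal) < extGromovProduct o (Sum.inr p.1) (Sum.inr p.2)}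
      refl := le_iInf fun n => by
        rw [le_principal_iff, mem_principal]
        rintro ⟨a, b⟩ (rfl : a = b)
        exact lt_extGromovProduct_self hδ a n
      symm := by
        refine tendsto_iInf.2 fun n => tendsto_iInf' n (tendsto_principal_principal.2 ?_)
        rintro ⟨a, b⟩ h
        rw [Set.mem_ofPred_eq, extGromovProduct_comm] at h
        exact h
      comp := by
        refine le_iInf fun n => ?_
        rw [le_principal_iff]
        -- Composing two entourages loses `δ` in the Gromov product.
        obtain ⟨m, hm⟩ := exists_nat_gt ((n : ℝ) + δ)
        refine mem_of_superset (mem_lift' (mem_iInf_of_mem m (mem_principal_self _))) ?_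
        rintro ⟨a, c⟩ ⟨b, h1, h2⟩
        exact lt_of_lt_of_le (EReal.coe_lt_coe_iff.2 (by linarith))
          (extGromovProduct_triangle hδ h1 h2) }

lemma boundaryUniformSpace_hasBasis {δ : ℝ} (hδ : IsHyperbolic X δ) (o : X) :
    (@uniformity _ (boundaryUniformSpace hδ o)).HasBasis (fun _ : ℕ => True) fun n : ℕ =>
      {p : Boundary o × Boundary o |
        ((n : ℝ) : EReal) < extGromovProduct o (Sum.inr p.1) (Sum.inr p.2)} := by
  refine hasBasis_iInf_principal (Antitone.directed_ge ?_)
  intro m n hmn p hp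
  exact lt_of_le_of_lt (EReal.coe_le_coe_iff.2 (by exact_mod_cast hmn)) hp

lemma boundaryUniformSpace_toTopologicalSpace {δ : ℝ} (hδ : IsHyperbolic X δ) (o : X) :
    (boundaryUniformSpace hδ o).toTopologicalSpace =
      (inferInstance : TopologicalSpace (Boundary o)) := by
  refine TopologicalSpace.ext_iff.2 fun s => ?_
  rw [@isOpen_uniformity _ (boundaryUniformSpace hδ o)]
  refine forall₂_congr fun ξ _ => ?_
  rw [(boundaryUniformSpace_hasBasis hδ o).mem_iff]
  constructor
  · rintro ⟨n, -, hn⟩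
    exact ⟨n, fun η hη => hn (a := (ξ, η)) hη rfl⟩
  · rintro ⟨R, hR⟩
    obtain ⟨n, hn⟩ := exists_nat_ge R
    refine ⟨n, trivial, ?_⟩
    rintro ⟨_, η⟩ hη rfl
    exact hR η (lt_of_le_of_lt (EReal.coe_le_coe_iff.2 hn) hη)

lemma pseudoMetrizableSpace_boundary {δ : ℝ} (hδ : IsHyperbolic X δ) (o : X) :
    TopologicalSpace.PseudoMetrizableSpace (Boundary o) := by
  let := boundaryUniformSpace hδ o
  have : (uniformity (Boundary o)).IsCountablyGenerated :=
    (boundaryUniformSpace_hasBasis hδ o).isCountablyGenerated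
  have h : @TopologicalSpace.PseudoMetrizableSpace (Boundary o)
      (boundaryUniformSpace hδ o).toTopologicalSpace :=
    UniformSpace.pseudoMetrizableSpace
  rwa [boundaryUniformSpace_toTopologicalSpace hδ o] at h

/-- The definition of open sets does not by itself make these sets neighbourhoods; the uniform
structure does. -/
lemma setOf_lt_extGromovProduct_mem_nhds {δ : ℝ} (hδ : IsHyperbolic X δ) {o : X} (ξ : Boundary o)
    (R : ℝ) : {η | (R : EReal) < extGromovProduct o (Sum.inr ξ) (Sum.inr η)} ∈ 𝓝 ξ := by
  have h := boundaryUniformSpace_toTopologicalSpace hδ o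
  change _ = instTopologicalSpaceBoundary o at h
  rw [← h, @mem_nhds_uniformity_iff_right _ (boundaryUniformSpace hδ o),
    (boundaryUniformSpace_hasBasis hδ o).mem_iff]
  obtain ⟨n, hn⟩ := exists_nat_ge R
  refine ⟨n, trivial, ?_⟩
  rintro ⟨_, η⟩ hη rfl
  exact lt_of_le_of_lt (EReal.coe_le_coe_iff.2 hn) hη

lemma tendsto_boundary {o : X} {ι : Type*} {l : Filter ι} {f : ι → Boundary o} {ξ : Boundary o}
    (h : ∀ R : ℝ, ∀ᶠ i in l, (R : EReal) < extGromovProduct o (Sum.inr ξ) (Sum.inr (f i))) :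
    Tendsto f l (𝓝 ξ) := by
  refine tendsto_nhds.2 fun s hs hξ => ?_
  obtain ⟨R, hR⟩ := hs ξ hξ
  exact (h R).mono fun i hi => hR _ hi

/-- If β_η(o,y) ≥ c for boundary points η → ξ, nearly optimal rays from o to η subconverge to a ray
from o to ξ that violates β_ξ(o,y) < c. -/
lemma upperSemicontinuous_busemann [ProperSpace X] (hX : IsGeodesicSpace X) {δ : ℝ}
    (hδ : IsHyperbolic X δ) (o y : X) :
    UpperSemicontinuous fun ξ : Boundary o => busemann ξ o y := by
  intro ξ c hc
  -- The supremum need not be attained, so rays are only asked to reach some `c' < c`.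
  obtain ⟨c', hc', hcc'⟩ := exists_between hc
  obtain ⟨τ, rfl⟩ := exists_endpoint_eq ξ
  have hσ : ∀ η : Boundary o, ∃ σ : GeodesicRay X, σ 0 = o ∧ σ.endpoint o = η ∧
      (c ≤ busemann η o y → c' ≤ busemannRay σ o y) := by
    intro η
    obtain ⟨ρ, hρ, hρc⟩ : ∃ ρ : GeodesicRay X, ρ.endpoint o = η ∧
        (c ≤ busemann η o y → c' ≤ busemannRay ρ o y) := by
      by_contra! hcon
      obtain ⟨ρ, hρ⟩ := exists_endpoint_eq η
      have h1 := busemann_le η fun σ hσ => (hcon σ hσ).2.le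
      linarith [(hcon ρ hρ).1]
    obtain ⟨σ, h0, h1, h2⟩ := exists_ray_from_busemannRay_le hX hδ ρ o y
    exact ⟨σ, h0, (h1.endpoint_eq o).trans hρ, fun h => (hρc h).trans h2⟩
  choose σ hσ0 hσe hσc using hσ
  refine mem_iff_ultrafilter.2 fun U hU => ?_
  by_contra hcon
  have hge : ∀ᶠ η in (U : Filter (Boundary o)), c ≤ busemann η o y := by
    refine (Ultrafilter.eventually_not.2 hcon).mono fun η hη => ?_
    simpa using hη
  obtain ⟨ρ, hρ0, hρ, hlim⟩ := exists_limit_ray hδ (o := o) U (fun η t => σ η t) o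
    (Eventually.of_forall hσ0) (fun s t => Eventually.of_forall fun η => (σ η).dist_eq s t) τ δ (by
      intro s
      filter_upwards [hU (setOf_lt_extGromovProduct_mem_nhds hδ (τ.endpoint o) s)] with η hη
      have hrep := represents_ray o (σ η)
      rw [hσe] at hrep
      obtain ⟨j, hj, hjs⟩ := ((eventually_lt_gromovProduct hη (represents_ray o τ) hrep).and
        (tendsto_natCast_atTop_atTop.eventually_ge_atTop s)).exists
      refine ⟨j, hjs, ?_⟩
      have h1 := hδ (σ η s) (σ η j) (τ j) o
      have h2 : gromovProduct o (σ η s) (σ η j) = s := by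
        have hjs' : (s : ℝ) ≤ (j : ℝ≥0) := hjs
        have h3 : o = σ η 0 := (hσ0 η).symm
        rw [gromovProduct, h3, (σ η).dist_eq, (σ η).dist_eq, (σ η).dist_eq,
          abs_of_nonpos (by simp), abs_of_nonpos (by simp), abs_of_nonpos (by linarith)]
        simp only [NNReal.coe_zero]
        ring
      refine le_trans (sub_le_sub_right (le_min h2.ge ?_) _) h1
      rw [gromovProduct_comm]
      exact hj.le)
  have h1 : c' ≤ busemannFun ρ y := by
    refine le_busemannFun ρ y fun t => ?_
    refine ge_of_tendsto ((tendsto_const_nhds.dist (hlim t)).sub_const _) ?_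
    filter_upwards [hge] with η hη
    refine (hσc η hη).trans (le_trans (le_of_eq ?_) (busemannFun_le (σ η) y t))
    have h2 := busemannFun_apply (σ η) 0
    rw [hσ0] at h2
    simp [busemannRay, h2]
  have h2 := busemannFun_apply ρ 0
  have h3 := busemannRay_le_busemann _ (hρ.endpoint_eq o) o y
  rw [hρ0] at h2
  rw [busemannRay, h2] at h3
  simp only [NNReal.coe_zero, neg_zero, sub_zero] at h3
  linarith

/-- ρ(x) maximises (η|x) up to integer rounding. Using integer thresholds, bounded through d(o,x),
ensures that the maximum is attained. -/
lemma exists_boundary_projection (o : X) [Nonempty (Boundary o)] :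
    ∃ ρ : X → Boundary o, ∀ (x : X) (η : Boundary o) (n : ℕ),
      ((n : ℝ) : EReal) < extGromovProduct o (Sum.inr η) (Sum.inl x) →
      ((n : ℝ) : EReal) < extGromovProduct o (Sum.inr (ρ x)) (Sum.inl x) := by
  refine ⟨_, fun x => Classical.choose_spec (p := fun ζ : Boundary o => ∀ (η : Boundary o) (n : ℕ),
    ((n : ℝ) : EReal) < extGromovProduct o (Sum.inr η) (Sum.inl x) →
    ((n : ℝ) : EReal) < extGromovProduct o (Sum.inr ζ) (Sum.inl x)) ?_⟩
  set A : Set ℕ := {n | ∃ η : Boundary o,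
    ((n : ℝ) : EReal) < extGromovProduct o (Sum.inr η) (Sum.inl x)} with hA
  rcases A.eq_empty_or_nonempty with hne | hne
  · refine ⟨Classical.arbitrary _, fun η n hn => ?_⟩
    have : n ∈ A := ⟨η, hn⟩
    simp [hne] at this
  · have hbdd : BddAbove A := by
      refine ⟨⌈dist o x⌉₊, ?_⟩
      rintro n ⟨η, hη⟩
      exact_mod_cast (lt_dist_of_lt_extGromovProduct hη).le.trans (Nat.le_ceil _)
    obtain ⟨ζ, hζ⟩ := Nat.sSup_mem hne hbdd
    refine ⟨ζ, fun η n hn => lt_of_le_of_lt (EReal.coe_le_coe_iff.2 ?_) hζ⟩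
    exact_mod_cast le_csSup hbdd ⟨η, hn⟩

/-- Once (ξ|x_k) > n, also (ρ(x_k)|x_k) > n, hence (ξ|ρ(x_k)) ≥ n - δ, and so ρ(x_k) → ξ. The map ρ
has no regularity, which is why `hx` is required for every ρ; it holds when x_k factors through a
discrete group. -/
lemma aemeasurable_of_convergesTo {δ : ℝ} (hδ : IsHyperbolic X δ) {o : X} {Ω : Type*}
    [MeasurableSpace Ω] {P : Measure Ω} [NeZero P] {x : ℕ → Ω → X} {xInf : Ω → Boundary o}
    (hx : ∀ n, ∀ ρ : X → Boundary o, AEMeasurable (fun ω => ρ (x n ω)) P)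
    (hconv : ∀ᵐ ω ∂P, ConvergesTo o (fun n => x n ω) (xInf ω)) : AEMeasurable xInf P := by
  have := pseudoMetrizableSpace_boundary hδ o
  obtain ⟨ω₀, -⟩ := hconv.exists
  have : Nonempty (Boundary o) := ⟨xInf ω₀⟩
  obtain ⟨ρ, hρ⟩ := exists_boundary_projection o
  refine aemeasurable_of_tendsto_metrizable_ae' (fun n => hx n ρ) ?_
  filter_upwards [hconv] with ω hω
  refine tendsto_boundary fun R => ?_
  obtain ⟨n, hn⟩ := exists_nat_gt (R + δ)
  filter_upwards [hω.eventually_lt n] with k hk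
  have h1 := hρ _ _ _ hk
  rw [extGromovProduct_comm] at h1
  exact lt_of_lt_of_le (EReal.coe_lt_coe_iff.2 (by linarith)) (extGromovProduct_triangle hδ hk h1)

end Boundary

/-! ### CAT(-1) spaces have property (P). -/

section CAT

/-! ### Trigonometry in the upper half-plane -/

lemma cosh_sub_sinh_mul_pos {k l : ℝ} (h : k ^ 2 + l ^ 2 = 1) (a : ℝ) :
    0 < Real.cosh a - Real.sinh a * k := by
  have h1 := Real.cosh_sq a
  have h2 : |Real.sinh a * k| < Real.cosh a := by
    refine abs_lt_of_sq_lt_sq ?_ (Real.cosh_pos a).le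
    nlinarith [sq_nonneg (Real.sinh a * l), mul_comm (Real.sinh a) k]
  linarith [(abs_lt.1 h2).2]

/-- The point of the upper half-plane at distance `a` from `i` in the direction `(k, l)`. -/
noncomputable def polarPoint {k l : ℝ} (h : k ^ 2 + l ^ 2 = 1) (a : ℝ) : UpperHalfPlane :=
  ⟨⟨Real.sinh a * l / (Real.cosh a - Real.sinh a * k), 1 / (Real.cosh a - Real.sinh a * k)⟩,
    one_div_pos.2 (cosh_sub_sinh_mul_pos h a)⟩

/-- This is the hyperbolic law of cosines, with k k' + l l' the cosine of the angle at i. -/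
lemma cosh_dist_polarPoint {k l k' l' : ℝ} (h : k ^ 2 + l ^ 2 = 1) (h' : k' ^ 2 + l' ^ 2 = 1)
    (a b : ℝ) : Real.cosh (dist (polarPoint h a) (polarPoint h' b)) =
      Real.cosh a * Real.cosh b - Real.sinh a * Real.sinh b * (k * k' + l * l') := by
  rw [UpperHalfPlane.cosh_dist']
  have h1 := cosh_sub_sinh_mul_pos h a
  have h2 := cosh_sub_sinh_mul_pos h' b
  have e1 : (polarPoint h a).re = Real.sinh a * l / (Real.cosh a - Real.sinh a * k) := rfl
  have e2 : (polarPoint h a).im = 1 / (Real.cosh a - Real.sinh a * k) := rfl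
  have e3 : (polarPoint h' b).re = Real.sinh b * l' / (Real.cosh b - Real.sinh b * k') := rfl
  have e4 : (polarPoint h' b).im = 1 / (Real.cosh b - Real.sinh b * k') := rfl
  rw [e1, e2, e3, e4]
  have ha := Real.cosh_sq a
  have hb := Real.cosh_sq b
  obtain ⟨p, hp⟩ : ∃ p, p = Real.cosh a - Real.sinh a * k := ⟨_, rfl⟩
  obtain ⟨q, hq⟩ : ∃ q, q = Real.cosh b - Real.sinh b * k' := ⟨_, rfl⟩
  rw [← hp, ← hq]
  rw [← hp] at h1
  rw [← hq] at h2
  have e5 : ((Real.sinh a * l / p - Real.sinh b * l' / q) ^ 2 + (1 / p) ^ 2 + (1 / q) ^ 2) /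
      (2 * (1 / p) * (1 / q)) =
      ((Real.sinh a * l * q - Real.sinh b * l' * p) ^ 2 + q ^ 2 + p ^ 2) / (2 * (p * q)) := by
    field_simp
  rw [e5, div_eq_iff (by positivity)]
  subst hp hq
  linear_combination (Real.cosh b - Real.sinh b * k') ^ 2 * (Real.sinh a ^ 2 * h - ha) +
    (Real.cosh a - Real.sinh a * k) ^ 2 * (Real.sinh b ^ 2 * h' - hb)

lemma eq_of_cosh_eq {a b : ℝ} (ha : 0 ≤ a) (hb : 0 ≤ b) (h : Real.cosh a = Real.cosh b) :
    a = b := by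
  have h1 := Real.cosh_le_cosh.1 h.le
  have h2 := Real.cosh_le_cosh.1 h.ge
  rw [abs_of_nonneg ha, abs_of_nonneg hb] at h1 h2
  exact le_antisymm h1 h2

lemma dist_polarPoint {k l : ℝ} (h : k ^ 2 + l ^ 2 = 1) {a b : ℝ} (hab : a ≤ b) :
    dist (polarPoint h a) (polarPoint h b) = b - a := by
  refine eq_of_cosh_eq dist_nonneg (by linarith) ?_
  rw [cosh_dist_polarPoint, Real.cosh_sub]
  linear_combination -(Real.sinh a * Real.sinh b) * h

lemma dist_polarPoint_zero {k l k' l' : ℝ} (h : k ^ 2 + l ^ 2 = 1) (h' : k' ^ 2 + l' ^ 2 = 1)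
    {b : ℝ} (hb : 0 ≤ b) : dist (polarPoint h 0) (polarPoint h' b) = b := by
  refine eq_of_cosh_eq dist_nonneg hb ?_
  rw [cosh_dist_polarPoint]
  simp

/-! ### Geodesic triangles in CAT(-1) spaces -/

variable {X : Type*} [MetricSpace X]

/-- By the law of cosines, cosh c - cosh(a - b) = sinh a · sinh b · (1 - cos θ) in the comparison
triangle. Applying it to the whole triangle and to the subtriangle at p eliminates the common angle
θ. -/
lemma IsCATNegOne.cosh_dist_le (hX : IsCATNegOne X) {p q r x y : X}
    (hx : dist p x + dist x q = dist p q) (hy : dist p y + dist y r = dist p r)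
    (hA : 0 < dist p q) (hB : 0 < dist p r) :
    (Real.cosh (dist x y) - Real.cosh (dist p x - dist p y)) *
        (Real.sinh (dist p q) * Real.sinh (dist p r)) ≤
      Real.sinh (dist p x) * Real.sinh (dist p y) *
        (Real.cosh (dist q r) - Real.cosh (dist p q - dist p r)) := by
  have hsA := Real.sinh_pos_iff.2 hA
  have hsB := Real.sinh_pos_iff.2 hB
  have hs := mul_pos hsA hsB
  -- `k` is the cosine of the comparison angle at `p`; the two triangle inequalities below amount to
  -- |k| ≤ 1.
  obtain ⟨k, hk⟩ : ∃ k, k * (Real.sinh (dist p q) * Real.sinh (dist p r)) =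
      Real.cosh (dist p q) * Real.cosh (dist p r) - Real.cosh (dist q r) :=
    ⟨_, div_mul_cancel₀ _ hs.ne'⟩
  have hk1 : k ≤ 1 := by
    have h1 : Real.cosh (dist p q - dist p r) ≤ Real.cosh (dist q r) := by
      rw [Real.cosh_le_cosh, abs_of_nonneg (dist_nonneg (x := q))]
      rw [dist_comm p q, dist_comm p r]
      exact abs_dist_sub_le q r p
    rw [Real.cosh_sub] at h1
    refine le_of_mul_le_mul_right ?_ hs
    linarith
  have hk2 : -1 ≤ k := by
    have h1 : Real.cosh (dist q r) ≤ Real.cosh (dist p q + dist p r) := by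
      rw [Real.cosh_le_cosh, abs_of_nonneg dist_nonneg, abs_of_nonneg (by positivity),
        dist_comm p q]
      exact dist_triangle _ _ _
    rw [Real.cosh_add] at h1
    refine le_of_mul_le_mul_right ?_ hs
    linarith
  have hkl : k ^ 2 + √(1 - k ^ 2) ^ 2 = 1 := by
    rw [Real.sq_sqrt (by nlinarith)]
    ring
  have h10 : (1 : ℝ) ^ 2 + (0 : ℝ) ^ 2 = 1 := by norm_num
  have key := hX.2 p q r x y hx hy (polarPoint h10 0) (polarPoint h10 (dist p q))
    (polarPoint hkl (dist p r)) (polarPoint h10 (dist p x)) (polarPoint hkl (dist p y))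
    (dist_polarPoint_zero _ _ dist_nonneg) (dist_polarPoint_zero _ _ dist_nonneg)
    (eq_of_cosh_eq dist_nonneg dist_nonneg (by
      rw [cosh_dist_polarPoint]
      linear_combination -hk))
    (dist_polarPoint_zero _ _ dist_nonneg)
    (by rw [dist_polarPoint _ (by linarith [dist_nonneg (x := x) (y := q)])]; linarith)
    (dist_polarPoint_zero _ _ dist_nonneg)
    (by rw [dist_polarPoint _ (by linarith [dist_nonneg (x := y) (y := r)])]; linarith)
  have h1 := Real.cosh_le_cosh.2 (abs_le_abs_of_nonneg dist_nonneg key)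
  rw [cosh_dist_polarPoint] at h1
  rw [Real.cosh_sub, Real.cosh_sub]
  have h2 := mul_le_mul_of_nonneg_right h1 hs.le
  linear_combination h2 - Real.sinh (dist p x) * Real.sinh (dist p y) * hk

lemma sinh_sub_le {A s : ℝ} (hs : 0 ≤ s) :
    Real.sinh (A - s) ≤ Real.exp (-s) * Real.sinh A := by
  have h1 : Real.exp (-s) * Real.exp A = Real.exp (A - s) := by
    rw [← Real.exp_add]
    ring_nf
  have h2 : Real.exp (-s) * Real.exp (-A) ≤ Real.exp (-(A - s)) := by
    rw [← Real.exp_add]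
    exact Real.exp_le_exp.2 (by linarith)
  rw [Real.sinh_eq, Real.sinh_eq]
  linarith

/-- Sides of a triangle of a CAT(-1) space approach each other exponentially fast. -/
lemma IsCATNegOne.cosh_dist_le_exp (hX : IsCATNegOne X) {p q r x y : X} {s D : ℝ}
    (hx : dist p x + dist x q = dist p q) (hy : dist p y + dist y r = dist p r)
    (hxs : dist x q = s) (hys : dist y r = s) (hA : 0 < dist p q) (hB : 0 < dist p r)
    (hD : dist q r ≤ D) :
    Real.cosh (dist x y) ≤
      Real.cosh (dist p q - dist p r) + Real.exp (-s) ^ 2 * Real.cosh D := by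
  have hs : 0 ≤ s := hxs ▸ dist_nonneg
  have key := hX.cosh_dist_le hx hy hA hB
  have hsA := Real.sinh_pos_iff.2 hA
  have hsB := Real.sinh_pos_iff.2 hB
  have h1 : Real.cosh (dist q r) ≤ Real.cosh D := Real.cosh_le_cosh.2 (by
    rwa [abs_of_nonneg dist_nonneg, abs_of_nonneg (dist_nonneg.trans hD)])
  have e1 : dist p x = dist p q - s := by linarith
  have e2 : dist p y = dist p r - s := by linarith
  have h2 : 0 ≤ Real.sinh (dist p x) := Real.sinh_nonneg_iff.2 dist_nonneg
  have h3 : 0 ≤ Real.sinh (dist p y) := Real.sinh_nonneg_iff.2 dist_nonneg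
  have h4 : Real.sinh (dist p x) ≤ Real.exp (-s) * Real.sinh (dist p q) :=
    e1 ▸ sinh_sub_le hs
  have h5 : Real.sinh (dist p y) ≤ Real.exp (-s) * Real.sinh (dist p r) :=
    e2 ▸ sinh_sub_le hs
  have h6 : dist p x - dist p y = dist p q - dist p r := by linarith
  rw [h6] at key
  have h7 : Real.sinh (dist p x) * Real.sinh (dist p y) *
      (Real.cosh (dist q r) - Real.cosh (dist p q - dist p r)) ≤
      Real.sinh (dist p x) * Real.sinh (dist p y) * Real.cosh D :=
    mul_le_mul_of_nonneg_left (by linarith [Real.cosh_pos (dist p q - dist p r)])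
      (mul_nonneg h2 h3)
  have h8 : Real.sinh (dist p x) * Real.sinh (dist p y) * Real.cosh D ≤
      (Real.exp (-s) * Real.sinh (dist p q)) * (Real.exp (-s) * Real.sinh (dist p r)) *
        Real.cosh D :=
    mul_le_mul_of_nonneg_right (mul_le_mul h4 h5 h3 (by positivity)) (Real.cosh_pos D).le
  have h9 := (key.trans h7).trans h8
  have h10 := le_of_mul_le_mul_right (h9.trans_eq (show _ = Real.exp (-s) ^ 2 * Real.cosh D *
    (Real.sinh (dist p q) * Real.sinh (dist p r)) by ring)) (mul_pos hsA hsB)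
  linarith

/-- Long sides of a triangle of a CAT(-1) space with a short base are close near the vertex. -/
lemma IsCATNegOne.cosh_dist_mul_le (hX : IsCATNegOne X) {p q r x y : X} {s D M : ℝ}
    (hx : dist p x + dist x q = dist p q) (hy : dist p y + dist y r = dist p r)
    (hxs : dist p x = s) (hys : dist p y = s) (hM : 0 < M) (hA : M ≤ dist p q)
    (hB : M ≤ dist p r) (hD : dist q r ≤ D) :
    (Real.cosh (dist x y) - 1) * (M * M) ≤ Real.sinh s ^ 2 * Real.cosh D := by
  have key := hX.cosh_dist_le hx hy (hM.trans_le hA) (hM.trans_le hB)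
  have h1 : Real.cosh (dist q r) ≤ Real.cosh D := Real.cosh_le_cosh.2 (by
    rwa [abs_of_nonneg dist_nonneg, abs_of_nonneg (dist_nonneg.trans hD)])
  have hsA : M ≤ Real.sinh (dist p q) := hA.trans (Real.self_le_sinh_iff.2 dist_nonneg)
  have hsB : M ≤ Real.sinh (dist p r) := hB.trans (Real.self_le_sinh_iff.2 dist_nonneg)
  rw [hxs, hys, sub_self, Real.cosh_zero] at key
  refine (mul_le_mul_of_nonneg_left (mul_le_mul hsA hsB hM.le (hM.le.trans hsA))
    (by linarith [Real.one_le_cosh (dist x y)])).trans (key.trans ?_)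
  rw [← sq]
  exact mul_le_mul_of_nonneg_left (by linarith [Real.cosh_pos (dist p q - dist p r)])
    (sq_nonneg _)

lemma sq_le_of_cosh_le {d κ : ℝ} (h : Real.cosh d ≤ 1 + κ) : d ^ 2 ≤ 2 * κ := by
  have h1 := Real.cosh_sq' (d / 2)
  have h2 := Real.cosh_two_mul (d / 2)
  rw [mul_div_cancel₀ d two_ne_zero] at h2
  have h3 : (d / 2) ^ 2 ≤ Real.sinh (d / 2) ^ 2 := by
    rw [sq_le_sq]
    exact Real.abs_sinh (d / 2) ▸ Real.self_le_sinh_iff.2 (abs_nonneg _)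
  nlinarith

/-- f_σ is 1-Lipschitz, so t ↦ f_σ(τ t) + t is nondecreasing, and it is bounded by D. The limit is
the parameter shift that aligns the Busemann levels of the two rays. -/
lemma exists_tendsto_busemannFun_add {σ τ : GeodesicRay X} (h : σ.Equivalent τ) :
    ∃ c : ℝ, Tendsto (fun t : ℝ≥0 => busemannFun σ (τ t) + t) atTop (𝓝 c) := by
  obtain ⟨D, hD⟩ := h
  refine ⟨_, tendsto_atTop_ciSup ?_ ⟨D, ?_⟩⟩
  · intro s t hst
    have h1 := busemannFun_le_add_dist σ (τ s) (τ t)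
    have h2 : (s : ℝ) ≤ t := hst
    rw [τ.dist_eq, abs_of_nonpos (by linarith)] at h1
    show busemannFun σ (τ s) + s ≤ busemannFun σ (τ t) + t
    linarith
  · rintro _ ⟨t, rfl⟩
    have h1 := busemannFun_le_add_dist σ (τ t) (σ t)
    rw [busemannFun_apply, dist_comm] at h1
    show busemannFun σ (τ t) + t ≤ D
    linarith [hD t]

lemma GeodesicRay.dist_toNNReal (σ : GeodesicRay X) {s t : ℝ} (hs : 0 ≤ s) (hst : s ≤ t) :
    dist (σ s.toNNReal) (σ t.toNNReal) = t - s := by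
  rw [σ.dist_eq, Real.coe_toNNReal _ hs, Real.coe_toNNReal _ (hs.trans hst),
    abs_of_nonpos (by linarith), neg_sub]

/-- Let a = σ₁(t), b = σ₂(t+c), z = σ₁(R), w = σ₂(R+c) with R very large. The points at distance s
from a and from b on the sides az and bz are close, because d(z,a) ≈ d(z,b) and s is large. The
points at distance s from b on bz and bw are close, because these sides are long and their base zw
is bounded. -/
lemma IsCATNegOne.propertyP (hX : IsCATNegOne X) : PropertyP X := by
  intro σ₁ σ₂ h
  obtain ⟨c, hc⟩ := exists_tendsto_busemannFun_add h
  obtain ⟨D, hD⟩ := h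
  refine ⟨c, Metric.tendsto_atTop.2 fun ε hε => ?_⟩
  -- The first triangle gives squared distance at most 4κ = (ε/4)², the second at most 2κ.
  set κ := ε ^ 2 / 64 with hκ
  have hκ0 : 0 < κ := by positivity
  set E := D + |c| with hE
  have hbd : ∀ t : ℝ, 0 ≤ t → 0 ≤ t + c →
      dist (σ₁ t.toNNReal) (σ₂ (t + c).toNNReal) ≤ E := by
    intro t ht htc
    refine (dist_triangle _ (σ₂ t.toNNReal) _).trans (add_le_add (hD _) ?_)
    rw [σ₂.dist_eq, Real.coe_toNNReal _ ht, Real.coe_toNNReal _ htc]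
    rw [show t - (t + c) = -c by ring, abs_neg]
  obtain ⟨s, hs, hs0⟩ : ∃ s : ℝ, Real.exp (-s) ^ 2 * Real.cosh E < κ ∧ 0 < s := by
    have h1 : Tendsto (fun s : ℝ => Real.exp (-s) ^ 2 * Real.cosh E) atTop
        (𝓝 (0 ^ 2 * Real.cosh E)) :=
      ((Real.tendsto_exp_neg_atTop_nhds_zero).pow 2).mul_const _
    rw [zero_pow two_ne_zero, zero_mul] at h1
    exact ((h1.eventually_lt_const hκ0).and (eventually_gt_atTop 0)).exists
  obtain ⟨η, hη, hη0⟩ : ∃ η : ℝ, Real.cosh η < 1 + κ ∧ 0 < η := by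
    have h1 : Tendsto Real.cosh (𝓝[>] 0) (𝓝 (Real.cosh 0)) :=
      Real.continuous_cosh.continuousWithinAt
    rw [Real.cosh_zero] at h1
    exact ((h1.eventually_lt_const (by linarith)).and self_mem_nhdsWithin).exists
  obtain ⟨N, hN⟩ := Metric.tendsto_atTop.1 hc (η / 2) (by linarith)
  refine ⟨N + s + |c| + s, fun r hr => ?_⟩
  rw [dist_zero_right, Real.norm_of_nonneg dist_nonneg]
  obtain ⟨t, rfl⟩ : ∃ t, r = t + s := ⟨r - s, by ring⟩
  have ht : (N : ℝ) + |c| + s ≤ t := by linarith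
  have hc1 := neg_abs_le c
  have ht0 : 0 ≤ t := le_trans (by positivity) ht
  have htc : (N : ℝ) ≤ t + c := by linarith
  have htc0 : 0 ≤ t + c := N.2.trans htc
  -- This says f_{σ₁}(b) ≈ -t = f_{σ₁}(σ₁ t): the shift `c` puts the two points on nearly the same
  -- level.
  have hfb := hN (t + c).toNNReal (NNReal.le_toNNReal_of_coe_le htc)
  rw [Real.dist_eq, Real.coe_toNNReal _ htc0] at hfb
  set b := σ₂ (t + c).toNNReal with hb
  obtain ⟨M, hM, hM0, hMs⟩ : ∃ M : ℝ, Real.sinh s ^ 2 * Real.cosh E ≤ κ * (M * M) ∧ 0 < M ∧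
      s ≤ M := by
    have h1 : Tendsto (fun M : ℝ => κ * (M * M)) atTop atTop :=
      (tendsto_id.atTop_mul_atTop₀ tendsto_id).const_mul_atTop hκ0
    exact ((h1.eventually_ge_atTop _).and
      ((eventually_gt_atTop 0).and (eventually_ge_atTop s))).exists
  -- For such `R`, d(b,z) differs from R - t = d(σ₁ t, z) by less than η.
  obtain ⟨R, hR, hRM⟩ : ∃ R : ℝ, |dist b (σ₁ R.toNNReal) - R - busemannFun σ₁ b| < η / 2 ∧
      t + M + η ≤ R := by
    have h1 := ((tendsto_busemannFun σ₁ b).comp tendsto_real_toNNReal_atTop)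
    obtain ⟨R, hR, hRM⟩ := ((Metric.tendsto_nhds.1 h1 (η / 2) (by linarith)).and
      (eventually_ge_atTop (t + M + η))).exists
    refine ⟨R, ?_, hRM⟩
    rwa [Function.comp_apply, Real.dist_eq, Real.coe_toNNReal _ (by linarith)] at hR
  set z := σ₁ R.toNNReal with hz
  rw [abs_lt] at hR hfb
  have hbz1 : dist b z - (R - t) < η := by linarith
  have hbz2 : -η < dist b z - (R - t) := by linarith
  have hbzM : M ≤ dist b z := by linarith
  obtain ⟨γ, hγ0, hγ1, hγ⟩ := hX.1 b z
  have hy1 : dist b (γ s) = s := by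
    have := hγ 0 ⟨le_rfl, dist_nonneg⟩ s ⟨hs0.le, by linarith⟩
    rwa [hγ0, zero_sub, abs_neg, abs_of_pos hs0] at this
  have hy2 : dist (γ s) z = dist b z - s := by
    have := hγ s ⟨hs0.le, by linarith⟩ (dist b z) ⟨dist_nonneg, le_rfl⟩
    rwa [hγ1, abs_of_nonpos (by linarith), neg_sub] at this
  have hza : dist z (σ₁ t.toNNReal) = R - t := by
    rw [dist_comm, σ₁.dist_toNNReal ht0 (by linarith)]
  have hzx : dist z (σ₁ (t + s).toNNReal) = R - (t + s) := by
    rw [dist_comm, σ₁.dist_toNNReal (by linarith) (by linarith)]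
  have hxa : dist (σ₁ (t + s).toNNReal) (σ₁ t.toNNReal) = s := by
    rw [dist_comm, σ₁.dist_toNNReal ht0 (by linarith)]
    ring
  have hbw : dist b (σ₂ (R + c).toNNReal) = R - t := by
    rw [σ₂.dist_toNNReal htc0 (by linarith)]
    ring
  have hbv : dist b (σ₂ (t + s + c).toNNReal) = s := by
    rw [σ₂.dist_toNNReal htc0 (by linarith)]
    ring
  have hvw : dist (σ₂ (t + s + c).toNNReal) (σ₂ (R + c).toNNReal) = R - (t + s) := by
    rw [σ₂.dist_toNNReal (by linarith) (by linarith)]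
    ring
  have h1 := hX.cosh_dist_le_exp (p := z) (q := σ₁ t.toNNReal) (r := b)
    (x := σ₁ (t + s).toNNReal) (y := γ s) (s := s) (D := E) (by linarith)
    (by rw [dist_comm z, dist_comm _ b, dist_comm z b]; linarith) hxa
    (by rw [dist_comm, hy1]) (by linarith) (by rw [dist_comm]; linarith) (hbd t ht0 htc0)
  have h2 := hX.cosh_dist_mul_le (p := b) (q := z) (r := σ₂ (R + c).toNNReal)
    (x := γ s) (y := σ₂ (t + s + c).toNNReal) (s := s) (D := E) (M := M) (by linarith)
    (by linarith) hy1 hbv hM0 hbzM (by linarith) (hbd R (by linarith) (by linarith))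
  have h3 : Real.cosh (dist z (σ₁ t.toNNReal) - dist z b) ≤ Real.cosh η := by
    rw [Real.cosh_le_cosh, abs_of_pos hη0, hza, dist_comm z b, abs_le]
    constructor <;> linarith
  have h4 : dist (σ₁ (t + s).toNNReal) (γ s) ^ 2 ≤ 2 * (2 * κ) := sq_le_of_cosh_le (by linarith)
  have h5 : dist (γ s) (σ₂ (t + s + c).toNNReal) ^ 2 ≤ 2 * κ := by
    refine sq_le_of_cosh_le ?_
    have := le_of_mul_le_mul_right (h2.trans hM) (mul_pos hM0 hM0)
    linarith
  have h6 : dist (σ₁ (t + s).toNNReal) (γ s) ≤ ε / 4 :=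
    abs_le_of_sq_le_sq' (by rw [hκ] at h4; linarith) (by linarith) |>.2
  have h7 : dist (γ s) (σ₂ (t + s + c).toNNReal) ≤ ε / 4 :=
    abs_le_of_sq_le_sq' (by rw [hκ] at h5; nlinarith) (by linarith) |>.2
  linarith [dist_triangle (σ₁ (t + s).toNNReal) (γ s) (σ₂ (t + s + c).toNNReal)]

end CAT

/-! ### The law of the walk and the convolution powers. -/

section Walk

/-! ### The law of the walk -/

variable {G Ω : Type*} [Group G] [MeasurableSpace G] [DiscreteMeasurableSpace G]

/-- For a large group G the product of two discrete σ-algebras need not be discrete, so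
multiplication may fail to be measurable; countable ranges avoid this. -/
lemma measurable_mul_of_countable_range {m : MeasurableSpace Ω} {f g : Ω → G}
    (hf : Measurable f) (hg : Measurable g) (hfc : (Set.range f).Countable)
    (hgc : (Set.range g).Countable) : Measurable fun ω => f ω * g ω := by
  intro s _
  have h : (fun ω => f ω * g ω) ⁻¹' s =
      ⋃ a ∈ Set.range f, ⋃ b ∈ Set.range g, {ω | f ω = a ∧ g ω = b ∧ a * b ∈ s} := by
    ext ω
    simp only [Set.mem_preimage, Set.mem_iUnion]
    constructor
    · intro h
      exact ⟨f ω, ⟨ω, rfl⟩, g ω, ⟨ω, rfl⟩, rfl, rfl, h⟩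
    · rintro ⟨a, -, b, -, rfl, rfl, h⟩
      exact h
  rw [h]
  refine MeasurableSet.biUnion hfc fun a _ => MeasurableSet.biUnion hgc fun b _ => ?_
  exact (hf (MeasurableSet.of_discrete (s := {a}))).inter
    ((hg (MeasurableSet.of_discrete (s := {b}))).inter (MeasurableSet.const _))

omit [MeasurableSpace G] [DiscreteMeasurableSpace G] in
lemma countable_range_walk {h : ℕ → Ω → G} (hc : ∀ n, (Set.range (h n)).Countable) (n : ℕ) :
    (Set.range (walk h n)).Countable := by
  induction n with
  | zero => exact (Set.countable_singleton 1).mono (by rintro _ ⟨ω, rfl⟩; rfl)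
  | succ n ih =>
    refine ((ih.prod (hc n)).image fun p => p.1 * p.2).mono ?_
    rintro _ ⟨ω, rfl⟩
    exact ⟨(walk h n ω, h n ω), ⟨⟨ω, rfl⟩, ⟨ω, rfl⟩⟩, rfl⟩

/-- The σ-algebra `m` is left free so that it can also be the one generated by the first n
increments, as independence requires. -/
lemma measurable_walk {m : MeasurableSpace Ω} {h : ℕ → Ω → G}
    (hc : ∀ n, (Set.range (h n)).Countable) {n : ℕ} (hm : ∀ i < n, Measurable (h i)) :
    Measurable (walk h n) := by
  induction n with
  | zero => exact measurable_const
  | succ n ih =>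
    exact measurable_mul_of_countable_range (ih fun i hi => hm i (hi.trans n.lt_succ_self))
      (hm n n.lt_succ_self) (countable_range_walk hc n) (hc n)

variable [MeasurableSpace Ω] {P : Measure Ω} {μ : PMF G} {h : ℕ → Ω → G}

lemma indepFun_walk (hc : ∀ n, (Set.range (h n)).Countable) (hm : ∀ n, Measurable (h n))
    (hi : iIndepFun h P) (n : ℕ) : IndepFun (walk h n) (h n) P := by
  have h1 := indep_iSup_of_disjoint (fun i => (hm i).comap_le) hi
    (Set.disjoint_singleton_right.2 (lt_irrefl n) : Disjoint (Set.Iio n) {n})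
  refine indep_of_indep_of_le_right (indep_of_indep_of_le_left h1 ?_) ?_
  · refine Measurable.comap_le (measurable_walk hc fun i hi => ?_)
    exact Measurable.of_comap_le (le_iSup₂ (f := fun i (_ : i ∈ Set.Iio n) =>
      MeasurableSpace.comap (h i) _) i hi)
  · exact le_iSup₂ (f := fun i (_ : i ∈ ({n} : Set ℕ)) => MeasurableSpace.comap (h i) _) n rfl

lemma tsum_bind_mul {α β : Type*} (p : PMF α) (f : α → PMF β) (F : β → ℝ≥0∞) :
    ∑' b, p.bind f b * F b = ∑' a, p a * ∑' b, f a b * F b := by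
  simp_rw [PMF.bind_apply, ← ENNReal.tsum_mul_right, ← ENNReal.tsum_mul_left]
  rw [ENNReal.tsum_comm]
  simp_rw [mul_assoc]

lemma tsum_map_mul {α β : Type*} (p : PMF α) (f : α → β) (F : β → ℝ≥0∞) :
    ∑' b, p.map f b * F b = ∑' a, p a * F (f a) := by
  rw [PMF.map, tsum_bind_mul]
  refine tsum_congr fun a => ?_
  rw [tsum_eq_single (f a) fun b hb => by simp [PMF.pure_apply, hb]]
  simp

omit [MeasurableSpace G] [DiscreteMeasurableSpace G] in
lemma map_mul_left_apply (μ : PMF G) (b a : G) : μ.map (fun g => b * g) a = μ (b⁻¹ * a) := by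
  classical
  rw [PMF.map_apply, tsum_eq_single (b⁻¹ * a)]
  · simp
  · intro g hg
    rw [if_neg]
    rintro rfl
    simp at hg

lemma measure_walk_preimage (hc : ∀ n, (Set.range (h n)).Countable)
    (hm : ∀ n, Measurable (h n)) (hi : iIndepFun h P) [IsProbabilityMeasure P]
    (hμ : ∀ n a, P (h n ⁻¹' {a}) = μ a) (n : ℕ) :
    ∀ a, P (walk h n ⁻¹' {a}) = convPow μ n a := by
  classical
  induction n with
  | zero =>
    intro a
    rw [convPow, PMF.pure_apply]
    split_ifs with ha
    · subst ha
      rw [show walk h 0 ⁻¹' {1} = Set.univ from Set.eq_univ_of_forall fun ω => rfl, measure_univ]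
    · rw [show walk h 0 ⁻¹' {a} = ∅ from
        Set.eq_empty_of_forall_notMem fun ω hω => ha (Eq.symm hω), measure_empty]
  | succ n ih =>
    intro a
    have hcr := countable_range_walk hc n
    have hset : walk h (n + 1) ⁻¹' {a} =
        ⋃ b ∈ Set.range (walk h n), (walk h n ⁻¹' {b} ∩ h n ⁻¹' {b⁻¹ * a}) := by
      ext ω
      simp only [Set.mem_preimage, Set.mem_singleton_iff, Set.mem_iUnion, Set.mem_inter_iff]
      constructor
      · rintro rfl
        exact ⟨_, ⟨ω, rfl⟩, rfl, by simp [walk]⟩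
      · rintro ⟨b, -, rfl, hb⟩
        simp [walk, hb]
    have hw := measurable_walk hc fun i (_ : i < n) => hm i
    rw [hset, measure_biUnion hcr]
    · simp_rw [(indepFun_walk hc hm hi n).measure_inter_preimage_eq_mul _ _
        MeasurableSet.of_discrete MeasurableSet.of_discrete, ih, hμ]
      rw [tsum_subtype_eq_of_support_subset
        (f := fun b => convPow μ n b * μ (b⁻¹ * a)), convPow, PMF.bind_apply]
      · simp_rw [map_mul_left_apply]
      · intro b hb
        by_contra hb'
        refine hb ?_
        show convPow μ n b * μ (b⁻¹ * a) = 0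
        rw [← ih, show walk h n ⁻¹' {b} = ∅ from
          Set.eq_empty_of_forall_notMem fun ω hω => hb' ⟨ω, hω⟩, measure_empty, zero_mul]
    · intro b _ b' _ hbb'
      refine Set.disjoint_left.2 fun ω h1 h2 => hbb' ?_
      exact h1.1.symm.trans h2.1
    · exact fun b _ => (hw MeasurableSet.of_discrete).inter (hm n MeasurableSet.of_discrete)

omit [Group G] in
lemma lintegral_comp_of_countable_range {Y : Ω → G} (hY : Measurable Y)
    (hc : (Set.range Y).Countable) (φ : G → ℝ≥0∞) :
    ∫⁻ ω, φ (Y ω) ∂P = ∑' a, P (Y ⁻¹' {a}) * φ a := by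
  have h1 : (P.map Y).restrict (Set.range Y) = P.map Y := by
    refine Measure.restrict_eq_self_of_ae_mem ?_
    rw [ae_map_iff hY.aemeasurable MeasurableSet.of_discrete]
    exact Eventually.of_forall fun ω => ⟨ω, rfl⟩
  rw [← lintegral_map (f := φ) (Measurable.of_discrete) hY, ← h1, lintegral_countable _ hc,
    tsum_subtype_eq_of_support_subset (f := fun a => φ a * P.map Y {a})]
  · refine tsum_congr fun a => ?_
    rw [Measure.map_apply hY MeasurableSet.of_discrete, mul_comm]
  · intro b hb
    by_contra hb'
    refine hb ?_
    show φ b * P.map Y {b} = 0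
    rw [Measure.map_apply hY MeasurableSet.of_discrete, show Y ⁻¹' {b} = ∅ from
      Set.eq_empty_of_forall_notMem fun ω hω => hb' ⟨ω, hω⟩, measure_empty, mul_zero]

/-- The support of μ is countable and carries almost every increment; values outside it are replaced
by 1. -/
lemma exists_countable_range_modification (hm : ∀ n, Measurable (h n)) (hi : iIndepFun h P)
    (hμ : ∀ n, P.map (h n) = μ.toMeasure) :
    ∃ h' : ℕ → Ω → G, (∀ n, (Set.range (h' n)).Countable) ∧ (∀ n, Measurable (h' n)) ∧
      iIndepFun h' P ∧ (∀ n a, P (h' n ⁻¹' {a}) = μ a) ∧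
      ∀ᵐ ω ∂P, ∀ n, walk h' n ω = walk h n ω := by
  classical
  set φ : G → G := fun g => if g ∈ μ.support then g else 1 with hφ
  have hae : ∀ n, φ ∘ h n =ᵐ[P] h n := by
    intro n
    have h1 : ∀ᵐ g ∂(P.map (h n)), g ∈ μ.support := by
      rw [hμ n]
      rw [ae_iff]
      exact (PMF.toMeasure_apply_eq_zero_iff μ MeasurableSet.of_discrete).2
        (Set.disjoint_left.2 fun g h1 h2 => h2 h1)
    filter_upwards [ae_of_ae_map (hm n).aemeasurable h1] with ω hω
    simp only [Function.comp_apply, hφ, if_pos hω]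
  refine ⟨fun n => φ ∘ h n, fun n => ?_, fun n => Measurable.of_discrete.comp (hm n),
    hi.comp (fun _ => φ) fun _ => Measurable.of_discrete, fun n a => ?_, ?_⟩
  · refine (μ.support_countable.union (Set.countable_singleton 1)).mono ?_
    rintro _ ⟨ω, rfl⟩
    by_cases hω : h n ω ∈ μ.support
    · exact Or.inl (by simpa only [Function.comp_apply, hφ, if_pos hω] using hω)
    · exact Or.inr (by simp only [Function.comp_apply, hφ, if_neg hω]; rfl)
  · rw [← Measure.map_apply (Measurable.of_discrete.comp (hm n)) MeasurableSet.of_discrete,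
      Measure.map_congr (hae n), hμ, PMF.toMeasure_apply_singleton _ _ MeasurableSet.of_discrete]
  · filter_upwards [ae_all_iff.2 hae] with ω hω n
    induction n with
    | zero => rfl
    | succ n ih =>
      rw [walk, walk, ih, ← hω n]

/-! ### Convolution powers -/

omit [MeasurableSpace G] [DiscreteMeasurableSpace G] in
-- The definition multiplies by new increments on the right; with m = 1 this identity isolates the
-- first increment on the left instead.
lemma convPow_add (μ : PMF G) (m n : ℕ) :
    convPow μ (m + n) = (convPow μ m).bind fun g => (convPow μ n).map fun h => g * h := by
  induction n with
  | zero =>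
    simp only [convPow, add_zero, PMF.pure_map, mul_one]
    exact (PMF.bind_pure _).symm
  | succ n ih =>
    rw [← add_assoc, convPow, ih, PMF.bind_bind]
    congr 1
    funext g
    rw [convPow, PMF.map_bind, PMF.bind_map]
    congr 1
    funext g'
    rw [Function.comp_apply, PMF.map_comp]
    congr 1
    funext k
    simp [mul_assoc]

omit [MeasurableSpace G] [DiscreteMeasurableSpace G] in
lemma convPow_one (μ : PMF G) : convPow μ 1 = μ := by
  simp only [convPow, PMF.pure_bind, one_mul]
  exact PMF.map_id μ

end Walk

/-! ### First moments, their subadditivity and their increments. -/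

section Moment

/-! ### First moments -/

variable {X : Type*} [MetricSpace X] {G : Subgroup (X ≃ᵢ X)} {o : X}

/-- The first moment with values in `[0, ∞]`. -/
noncomputable def eMoment (o : X) (μ : PMF G) : ℝ≥0∞ :=
  ∑' g : G, μ g * ENNReal.ofReal (dist o (g.1 o))

lemma toReal_mul_ofReal_dist (μ : PMF G) (g : G) :
    (μ g * ENNReal.ofReal (dist o (g.1 o))).toReal = (μ g).toReal * dist o (g.1 o) := by
  rw [ENNReal.toReal_mul, ENNReal.toReal_ofReal dist_nonneg]

lemma hasFiniteFirstMoment_iff (μ : PMF G) : HasFiniteFirstMoment o μ ↔ eMoment o μ ≠ ∞ := by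
  constructor
  · intro h
    have h1 := Summable.tsum_ofReal_ne_top h
    simp_rw [ENNReal.ofReal_mul ENNReal.toReal_nonneg, ENNReal.ofReal_toReal (μ.apply_ne_top _)]
      at h1
    exact h1
  · intro h
    have h1 := ENNReal.summable_toReal h
    simp_rw [toReal_mul_ofReal_dist] at h1
    exact h1

lemma toReal_eMoment (μ : PMF G) : (eMoment o μ).toReal = firstMoment o μ := by
  rw [eMoment, ENNReal.tsum_toReal_eq
    fun g => ENNReal.mul_ne_top (μ.apply_ne_top g) ENNReal.ofReal_ne_top]
  simp_rw [toReal_mul_ofReal_dist]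
  rfl

lemma dist_inv_apply (g : G) (x y : X) : dist (g⁻¹.1 x) y = dist x (g.1 y) := by
  rw [← g.1.isometry.dist_eq (g⁻¹.1 x) y]
  congr 1
  exact g.1.apply_symm_apply x

lemma dist_mul_apply_le (g k : G) :
    dist o ((g * k).1 o) ≤ dist o (g.1 o) + dist o (k.1 o) := by
  have h1 := dist_triangle o (g.1 o) (g.1 (k.1 o))
  rw [g.1.isometry.dist_eq] at h1
  exact h1

lemma eMoment_convPow_add_le (μ : PMF G) (m n : ℕ) :
    eMoment o (convPow μ (m + n)) ≤ eMoment o (convPow μ m) + eMoment o (convPow μ n) := by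
  rw [convPow_add, eMoment, tsum_bind_mul]
  simp_rw [tsum_map_mul]
  calc ∑' a, convPow μ m a * ∑' b, convPow μ n b * ENNReal.ofReal (dist o ((a * b).1 o))
      ≤ ∑' a, convPow μ m a * (ENNReal.ofReal (dist o (a.1 o)) + eMoment o (convPow μ n)) := by
        refine ENNReal.tsum_le_tsum fun a => mul_le_mul_right ?_ _
        calc ∑' b, convPow μ n b * ENNReal.ofReal (dist o ((a * b).1 o))
            ≤ ∑' b, (convPow μ n b * ENNReal.ofReal (dist o (a.1 o)) +
                convPow μ n b * ENNReal.ofReal (dist o (b.1 o))) := by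
              refine ENNReal.tsum_le_tsum fun b => ?_
              rw [← mul_add, ← ENNReal.ofReal_add dist_nonneg dist_nonneg]
              exact mul_le_mul_right (ENNReal.ofReal_le_ofReal (dist_mul_apply_le a b)) _
          _ = _ := by
              rw [ENNReal.tsum_add, ENNReal.tsum_mul_right, PMF.tsum_coe, one_mul]
              rfl
    _ = _ := by
        simp_rw [mul_add]
        rw [ENNReal.tsum_add, ENNReal.tsum_mul_right, PMF.tsum_coe, one_mul]
        rfl

lemma eMoment_convPow_ne_top {μ : PMF G} (hμ : eMoment o μ ≠ ∞) (n : ℕ) :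
    eMoment o (convPow μ n) ≠ ∞ := by
  induction n with
  | zero =>
    rw [eMoment, convPow, tsum_eq_single 1 fun b hb => by simp [PMF.pure_apply, hb]]
    exact ENNReal.mul_ne_top (PMF.apply_ne_top _ _) ENNReal.ofReal_ne_top
  | succ n ih =>
    refine ne_top_of_le_ne_top (ENNReal.add_ne_top.2 ⟨ih, ?_⟩) (eMoment_convPow_add_le μ n 1)
    rwa [convPow_one]

/-- Fekete's lemma for the subadditive sequence of first moments. -/
lemma exists_tendsto_firstMoment {μ : PMF G} (hμ : eMoment o μ ≠ ∞) :
    ∃ l : ℝ, Tendsto (fun n : ℕ => firstMoment o (convPow μ n) / n) atTop (𝓝 l) := by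
  have hsub : Subadditive fun n => firstMoment o (convPow μ n) := by
    intro m n
    simp_rw [← toReal_eMoment]
    rw [← ENNReal.toReal_add (eMoment_convPow_ne_top hμ m) (eMoment_convPow_ne_top hμ n)]
    exact ENNReal.toReal_mono (ENNReal.add_ne_top.2
      ⟨eMoment_convPow_ne_top hμ m, eMoment_convPow_ne_top hμ n⟩) (eMoment_convPow_add_le μ m n)
  refine ⟨_, hsub.tendsto_lim ⟨0, ?_⟩⟩
  rintro _ ⟨n, rfl⟩
  show 0 ≤ firstMoment o (convPow μ n) / n
  rw [← toReal_eMoment]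
  positivity

/-! ### Increments of the first moments -/

variable [MeasurableSpace G] [DiscreteMeasurableSpace G] {Ω : Type*} [MeasurableSpace Ω]
  {P : Measure Ω} [IsProbabilityMeasure P] {μ : PMF G} {W : ℕ → Ω → G}

lemma integrable_dist_walk (hμ : eMoment o μ ≠ ∞) (hW : ∀ n, Measurable (W n))
    (hc : ∀ n, (Set.range (W n)).Countable) (hlaw : ∀ n a, P (W n ⁻¹' {a}) = convPow μ n a)
    (n : ℕ) (y : X) : Integrable (fun ω => dist y ((W n ω).1 o)) P := by
  have hmeas : ∀ y : X, Measurable fun ω => dist y ((W n ω).1 o) := fun y =>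
    (Measurable.of_discrete (f := fun g : G => dist y (g.1 o))).comp (hW n)
  have h1 : Integrable (fun ω => dist o ((W n ω).1 o)) P := by
    refine ⟨(hmeas o).aestronglyMeasurable, ?_⟩
    rw [hasFiniteIntegral_iff_ofReal (Eventually.of_forall fun ω => dist_nonneg),
      lintegral_comp_of_countable_range (hW n) (hc n)
        (fun g => ENNReal.ofReal (dist o (g.1 o)))]
    simp_rw [hlaw]
    exact (eMoment_convPow_ne_top hμ n).lt_top
  refine ((integrable_const (dist y o)).add h1).mono' (hmeas y).aestronglyMeasurable
    (Eventually.of_forall fun ω => ?_)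
  rw [Real.norm_of_nonneg dist_nonneg]
  exact dist_triangle _ _ _

omit [IsProbabilityMeasure P] in
lemma integral_dist_walk (hW : ∀ n, Measurable (W n))
    (hc : ∀ n, (Set.range (W n)).Countable) (hlaw : ∀ n a, P (W n ⁻¹' {a}) = convPow μ n a)
    (n : ℕ) (y : X) : ∫ ω, dist y ((W n ω).1 o) ∂P =
      (∑' a, convPow μ n a * ENNReal.ofReal (dist y (a.1 o))).toReal := by
  have hmeas : Measurable fun ω => dist y ((W n ω).1 o) :=
    (Measurable.of_discrete (f := fun g : G => dist y (g.1 o))).comp (hW n)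
  rw [integral_eq_lintegral_of_nonneg_ae (Eventually.of_forall fun ω => dist_nonneg)
    hmeas.aestronglyMeasurable, lintegral_comp_of_countable_range (hW n) (hc n)
        (fun g => ENNReal.ofReal (dist y (g.1 o)))]
  simp_rw [hlaw]

lemma summable_toReal_apply {α : Type*} (p : PMF α) : Summable fun a => (p a).toReal :=
  ENNReal.summable_toReal p.tsum_coe_ne_top

lemma tsum_toReal_apply {α : Type*} (p : PMF α) : ∑' a, (p a).toReal = 1 := by
  rw [← ENNReal.tsum_toReal_eq p.apply_ne_top, p.tsum_coe, ENNReal.toReal_one]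

/-- Isolating the first increment g and using d(o, g a o) = d(g⁻¹o, a o) expresses L(μ^{n+1})
through μ and the law of `W n`. Nothing else about `W` enters. -/
lemma hasSum_firstMoment_sub (hμ : eMoment o μ ≠ ∞) (hW : ∀ n, Measurable (W n))
    (hc : ∀ n, (Set.range (W n)).Countable) (hlaw : ∀ n a, P (W n ⁻¹' {a}) = convPow μ n a)
    (n : ℕ) :
    HasSum (fun g : G => (μ g).toReal *
        ∫ ω, (dist (g⁻¹.1 o) ((W n ω).1 o) - dist o ((W n ω).1 o)) ∂P)
      (firstMoment o (convPow μ (n + 1)) - firstMoment o (convPow μ n)) := by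
  have hint := integrable_dist_walk (o := o) hμ hW hc hlaw n
  have h1 : eMoment o (convPow μ (n + 1)) =
      ∑' g, μ g * ∑' a, convPow μ n a * ENNReal.ofReal (dist (g⁻¹.1 o) (a.1 o)) := by
    rw [add_comm, convPow_add, convPow_one, eMoment, tsum_bind_mul]
    simp_rw [tsum_map_mul, dist_inv_apply]
    rfl
  have hne : ∑' g, μ g * ∑' a, convPow μ n a * ENNReal.ofReal (dist (g⁻¹.1 o) (a.1 o)) ≠ ∞ :=
    h1 ▸ eMoment_convPow_ne_top hμ (n + 1)
  have h2 : HasSum (fun g : G => (μ g).toReal * ∫ ω, dist (g⁻¹.1 o) ((W n ω).1 o) ∂P)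
      (firstMoment o (convPow μ (n + 1))) := by
    have h3 := ENNReal.hasSum_toReal hne
    rw [← ENNReal.tsum_toReal_eq (ENNReal.ne_top_of_tsum_ne_top hne), ← h1, toReal_eMoment] at h3
    simp_rw [integral_dist_walk hW hc hlaw, ← ENNReal.toReal_mul]
    exact h3
  have h4 : HasSum (fun g : G => (μ g).toReal * ∫ ω, dist o ((W n ω).1 o) ∂P)
      (firstMoment o (convPow μ n)) := by
    have h5 := (summable_toReal_apply μ).hasSum.mul_right (∫ ω, dist o ((W n ω).1 o) ∂P)
    have h6 : ∫ ω, dist o ((W n ω).1 o) ∂P = firstMoment o (convPow μ n) := by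
      rw [integral_dist_walk hW hc hlaw, ← toReal_eMoment]
      rfl
    rw [tsum_toReal_apply, one_mul] at h5
    rwa [h6] at h5 ⊢
  have h7 := h2.sub h4
  simp_rw [← mul_sub, ← integral_sub (hint _) (hint _)] at h7
  exact h7

end Moment

/-! ### Dominated convergence and the integral formula. -/

section Escape

/-! ### The integral formula -/

variable {X : Type*} [MetricSpace X] [ProperSpace X] {o : X} {δ : ℝ}

lemma measurable_busemann (hX : IsGeodesicSpace X) (hδ : IsHyperbolic X δ) (y : X) :
    Measurable fun ξ : Boundary o => busemann ξ o y :=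
  (upperSemicontinuous_busemann hX hδ o y).measurable

lemma integrable_busemann (hX : IsGeodesicSpace X) (hδ : IsHyperbolic X δ) (y : X)
    (ν : Measure (Boundary o)) [IsFiniteMeasure ν] :
    Integrable (fun ξ : Boundary o => busemann ξ o y) ν :=
  (integrable_const (dist o y)).mono' (measurable_busemann hX hδ y).aestronglyMeasurable
    (Eventually.of_forall fun ξ => abs_busemann_le ξ o y)

omit [ProperSpace X] in
lemma dist_inv_apply_self {G : Subgroup (X ≃ᵢ X)} (g : G) :
    dist o (g⁻¹.1 o) = dist o (g.1 o) := by
  rw [dist_comm, dist_inv_apply]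

omit [ProperSpace X] in
lemma summable_mul_integral_busemann {G : Subgroup (X ≃ᵢ X)} {μ : PMF G}
    (hμ : HasFiniteFirstMoment o μ) (ν : Measure (Boundary o)) [IsProbabilityMeasure ν] :
    Summable fun g : G => (μ g).toReal * ∫ ξ, busemann ξ o (g⁻¹.1 o) ∂ν := by
  refine Summable.of_norm_bounded hμ fun g => ?_
  rw [norm_mul, Real.norm_of_nonneg ENNReal.toReal_nonneg]
  refine mul_le_mul_of_nonneg_left ?_ ENNReal.toReal_nonneg
  have h1 := norm_integral_le_of_norm_le_const (μ := ν) (f := fun ξ => busemann ξ o (g⁻¹.1 o))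
    (Eventually.of_forall fun ξ => abs_busemann_le ξ o (g⁻¹.1 o))
  rwa [probReal_univ, mul_one, dist_inv_apply_self] at h1

variable {G : Subgroup (X ≃ᵢ X)} [MeasurableSpace G] [DiscreteMeasurableSpace G]
  {Ω : Type*} [MeasurableSpace Ω] {P : Measure Ω} [IsProbabilityMeasure P] {μ : PMF G}
  {W : ℕ → Ω → G} {xInf : Ω → Boundary o}

/-- The distance to β_ξ need not converge when C > 0; only its excess over C tends to 0, so
dominated convergence is applied to the excess. -/
lemma tendsto_integral_excess (hX : IsGeodesicSpace X) (hδ : IsHyperbolic X δ) {C : ℝ}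
    (hC0 : 0 ≤ C) (hC : ∀ σ τ : GeodesicRay X, σ.Equivalent τ → ∀ x y : X,
      busemannRay σ x y ≤ busemannRay τ x y + C) (hW : ∀ n, Measurable (W n))
    (hxInf : AEMeasurable xInf P)
    (hconv : ∀ᵐ ω ∂P, ConvergesTo o (fun n => (W n ω).1 o) (xInf ω)) (y : X) :
    Tendsto (fun n => ∫ ω, max (|dist y ((W n ω).1 o) - dist o ((W n ω).1 o) -
      busemann (xInf ω) o y| - C) 0 ∂P) atTop (𝓝 0) := by
  rw [show (𝓝 (0 : ℝ)) = 𝓝 (∫ _, (0 : ℝ) ∂P) by rw [integral_zero]]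
  refine tendsto_integral_of_dominated_convergence (fun _ => 2 * dist o y) (fun n => ?_)
    (integrable_const _) (fun n => Eventually.of_forall fun ω => ?_) ?_
  · have h1 : Measurable fun ω => dist y ((W n ω).1 o) - dist o ((W n ω).1 o) :=
      (Measurable.of_discrete (f := fun g : G => dist y (g.1 o) - dist o (g.1 o))).comp (hW n)
    have h2 : AEMeasurable (fun ω => busemann (xInf ω) o y) P :=
      (measurable_busemann hX hδ y).comp_aemeasurable hxInf
    have h3 : AEMeasurable (fun ω => |dist y ((W n ω).1 o) - dist o ((W n ω).1 o) -
        busemann (xInf ω) o y|) P := continuous_abs.measurable.comp_aemeasurable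
          (h1.aemeasurable.sub h2)
    exact ((h3.sub_const C).max aemeasurable_const).aestronglyMeasurable
  · rw [Real.norm_of_nonneg (le_max_right _ _)]
    refine max_le ?_ (by positivity)
    have h1 := abs_busemann_le (xInf ω) o y
    have h2 := abs_dist_sub_le y o ((W n ω).1 o)
    rw [dist_comm y o] at h2
    have h3 := abs_sub (dist y ((W n ω).1 o) - dist o ((W n ω).1 o)) (busemann (xInf ω) o y)
    linarith
  · filter_upwards [hconv] with ω hω
    refine Metric.tendsto_nhds.2 fun ε hε => ?_
    filter_upwards [hω.eventually_abs_le hX hδ hC y (half_pos hε)] with n hn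
    rw [dist_zero_right, Real.norm_of_nonneg (le_max_right _ _)]
    exact max_lt (by linarith) hε

lemma abs_rateOfEscape_sub_busemannDrift_le (hX : IsGeodesicSpace X) (hδ : IsHyperbolic X δ)
    {C : ℝ} (hC : ∀ σ τ : GeodesicRay X, σ.Equivalent τ → ∀ x y : X,
      busemannRay σ x y ≤ busemannRay τ x y + C)
    (hμ : HasFiniteFirstMoment o μ) (hW : ∀ n, Measurable (W n))
    (hc : ∀ n, (Set.range (W n)).Countable) (hlaw : ∀ n a, P (W n ⁻¹' {a}) = convPow μ n a)
    (hxInf : AEMeasurable xInf P)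
    (hconv : ∀ᵐ ω ∂P, ConvergesTo o (fun n => (W n ω).1 o) (xInf ω)) :
    |rateOfEscape o μ - busemannDrift o μ (P.map xInf)| ≤ C := by
  have hμ' := (hasFiniteFirstMoment_iff μ).1 hμ
  have : IsProbabilityMeasure (P.map xInf) := Measure.isProbabilityMeasure_map hxInf
  set Z : ℕ → G → Ω → ℝ := fun n g ω =>
    dist (g⁻¹.1 o) ((W n ω).1 o) - dist o ((W n ω).1 o) with hZ
  set B : G → Ω → ℝ := fun g ω => busemann (xInf ω) o (g⁻¹.1 o) with hB
  set e : ℕ → G → ℝ := fun n g => ∫ ω, max (|Z n g ω - B g ω| - C) 0 ∂P with he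
  set b : ℕ → ℝ := fun n => ∑' g, (μ g).toReal * e n g with hb
  have hBint : ∀ g, Integrable (B g) P := fun g =>
    (integrable_busemann hX hδ (g⁻¹.1 o) (P.map xInf)).comp_aemeasurable hxInf
  have hZint : ∀ n g, Integrable (Z n g) P := fun n g =>
    (integrable_dist_walk hμ' hW hc hlaw n _).sub (integrable_dist_walk hμ' hW hc hlaw n _)
  have hBν : ∀ g : G, ∫ ξ, busemann ξ o (g⁻¹.1 o) ∂(P.map xInf) = ∫ ω, B g ω ∂P := fun g =>
    integral_map hxInf (measurable_busemann hX hδ _).aestronglyMeasurable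
  have heint : ∀ n g, Integrable (fun ω => max (|Z n g ω - B g ω| - C) 0) P := fun n g =>
    ((((hZint n g).sub (hBint g)).abs.sub (integrable_const C)).sup (integrable_const 0))
  -- Comparing a ray with itself gives the sign; a ray exists because `xInf` takes values in the
  -- boundary.
  have hC0 : 0 ≤ C := by
    obtain ⟨ω, -⟩ := hconv.exists
    obtain ⟨σ, -⟩ := exists_endpoint_eq (xInf ω)
    linarith [hC σ σ (GeodesicRay.Equivalent.refl σ) o o]
  have hebd : ∀ n g, ‖(μ g).toReal * e n g‖ ≤ 2 * ((μ g).toReal * dist o (g.1 o)) := by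
    intro n g
    have h0 : 0 ≤ e n g := integral_nonneg fun ω => le_max_right _ _
    have h1 : e n g ≤ 2 * dist o (g.1 o) := by
      have h2 : e n g ≤ ∫ _, 2 * dist o (g.1 o) ∂P := by
        refine integral_mono (heint n g) (integrable_const _) fun ω => max_le ?_ (by positivity)
        have h1 := abs_busemann_le (xInf ω) o (g⁻¹.1 o)
        have h2 := abs_dist_sub_le (g⁻¹.1 o) o ((W n ω).1 o)
        rw [dist_comm _ o, dist_inv_apply_self] at h2
        rw [dist_inv_apply_self] at h1
        have h3 := abs_sub (Z n g ω) (B g ω)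
        simp only [hZ, hB] at h3 ⊢
        linarith
      simpa using h2
    rw [Real.norm_of_nonneg (mul_nonneg ENNReal.toReal_nonneg h0), mul_left_comm]
    exact mul_le_mul_of_nonneg_left h1 ENNReal.toReal_nonneg
  -- Dominated convergence again, now for the sum over G, with dominating series 2 Σ μ(g) d(o,go).
  have hb0 : Tendsto b atTop (𝓝 0) := by
    have h1 := tendsto_tsum_of_dominated_convergence (f := fun n g => (μ g).toReal * e n g)
      (g := fun g => (μ g).toReal * 0) (𝓕 := atTop) (hμ.mul_left 2)
      (fun g => (tendsto_integral_excess hX hδ hC0 hC hW hxInf hconv (g⁻¹.1 o)).const_mul _)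
      (Eventually.of_forall fun n g => hebd n g)
    simpa using h1
  have hstep : ∀ n, |firstMoment o (convPow μ (n + 1)) - firstMoment o (convPow μ n) -
      busemannDrift o μ (P.map xInf)| ≤ C + b n := by
    intro n
    have h1 := (hasSum_firstMoment_sub (o := o) hμ' hW hc hlaw n).sub
      (summable_mul_integral_busemann hμ (P.map xInf)).hasSum
    have h2 := ((summable_toReal_apply μ).hasSum.mul_left C).add
      (Summable.of_norm_bounded (hμ.mul_left 2) (hebd n)).hasSum
    rw [tsum_toReal_apply, mul_one] at h2
    refine (Real.norm_eq_abs _).symm.trans_le (h1.norm_le_of_bounded h2 fun g => ?_)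
    rw [hBν, ← mul_sub, ← integral_sub (hZint n g) (hBint g), norm_mul,
      Real.norm_of_nonneg ENNReal.toReal_nonneg, mul_comm C, ← mul_add]
    refine mul_le_mul_of_nonneg_left ?_ ENNReal.toReal_nonneg
    have h3 : ∫ ω, |Z n g ω - B g ω| ∂P ≤ ∫ ω, (C + max (|Z n g ω - B g ω| - C) 0) ∂P := by
      refine integral_mono ((hZint n g).sub (hBint g)).abs
        ((integrable_const C).add (heint n g)) fun ω => ?_
      have := le_max_left (|Z n g ω - B g ω| - C) 0
      simp only
      linarith
    rw [integral_add (integrable_const C) (heint n g)] at h3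
    refine (norm_integral_le_integral_norm _).trans (h3.trans ?_)
    simp [he]
  -- Telescoping, starting from L(μ⁰) = 0.
  have hsum : ∀ n : ℕ, |firstMoment o (convPow μ n) - n * busemannDrift o μ (P.map xInf)| ≤
      n * C + ∑ i ∈ Finset.range n, b i := by
    intro n
    induction n with
    | zero =>
      have h1 : firstMoment o (convPow μ 0) = 0 := by
        refine (tsum_eq_single 1 fun g hg => ?_).trans ?_
        · simp [convPow, PMF.pure_apply, hg]
        · have : ((1 : G).1 o) = o := rfl
          rw [this, dist_self, mul_zero]
      simp [h1]
    | succ n ih =>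
      rw [Finset.sum_range_succ]
      have h1 := abs_le.1 ih
      have h2 := abs_le.1 (hstep n)
      push_cast
      rw [abs_le]
      constructor <;> linarith
  obtain ⟨l, hl⟩ := exists_tendsto_firstMoment hμ'
  rw [rateOfEscape, hl.limUnder_eq]
  have hlim : Tendsto (fun n : ℕ => C + (n : ℝ)⁻¹ * ∑ i ∈ Finset.range n, b i) atTop
      (𝓝 (C + 0)) := hb0.cesaro.const_add C
  rw [add_zero] at hlim
  refine le_of_tendsto_of_tendsto ((hl.sub_const _).abs) hlim ?_
  filter_upwards [eventually_gt_atTop 0] with n hn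
  have hn' : (0 : ℝ) < n := by exact_mod_cast hn
  have h1 : firstMoment o (convPow μ n) / n - busemannDrift o μ (P.map xInf) =
      (n : ℝ)⁻¹ * (firstMoment o (convPow μ n) - n * busemannDrift o μ (P.map xInf)) := by
    field_simp
  have h2 : C + (n : ℝ)⁻¹ * ∑ i ∈ Finset.range n, b i =
      (n : ℝ)⁻¹ * (n * C + ∑ i ∈ Finset.range n, b i) := by
    field_simp
  rw [h1, h2, abs_mul, abs_of_pos (inv_pos.2 hn')]
  exact mul_le_mul_of_nonneg_left (hsum n) (inv_pos.2 hn').le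

end Escape

end HypWalk

theorem mainTheorem4 :
    ∃ C₂ : ℝ → ℝ,
      ∀ (X : Type u) [MetricSpace X] [ProperSpace X] (δ : ℝ) (o : X)
        (G : Subgroup (X ≃ᵢ X)) [MeasurableSpace G] [DiscreteMeasurableSpace G]
        (μ : PMF G)
        (Ω : Type v) [MeasurableSpace Ω] (P : Measure Ω) [IsProbabilityMeasure P]
        (h : ℕ → Ω → G) (xInf : Ω → Boundary o),
        IsGeodesicSpace X → IsHyperbolic X δ →
        HasFiniteFirstMoment o μ →
        -- `h` is a sequence of independent `μ`-distributed increments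
        (∀ n, Measurable (h n)) → iIndepFun h P → (∀ n, P.map (h n) = μ.toMeasure) →
        -- the walk converges almost surely to `xInf`
        (∀ᵐ ω ∂P, ConvergesTo o (fun n => (walk h n ω).1 o) (xInf ω)) →
        -- the law `ν = P.map xInf`, the rate of escape, the integrals and the sum are well defined
        AEMeasurable xInf P ∧
        (∃ l : ℝ, Tendsto (fun n : ℕ => firstMoment o (convPow μ n) / n) atTop (𝓝 l)) ∧
        (∀ n : ℕ, HasFiniteFirstMoment o (convPow μ n)) ∧
        (∀ g : G, Integrable (fun ξ => busemann ξ o (g⁻¹.1 o)) (P.map xInf)) ∧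
        (Summable fun g : G => (μ g).toReal * ∫ ξ, busemann ξ o (g⁻¹.1 o) ∂(P.map xInf)) ∧
        -- the formula up to a constant, and the exact formula under property (P)
        |rateOfEscape o μ - busemannDrift o μ (P.map xInf)| ≤ C₂ δ ∧
        (PropertyP X → rateOfEscape o μ = busemannDrift o μ (P.map xInf)) ∧
        (IsCATNegOne X → PropertyP X) := by
  refine ⟨fun δ => 2 * δ, ?_⟩
  intro X _ _ δ o G _ _ μ Ω _ P _ h xInf hX hδ hμ hm hi hlaw hconv
  -- The modified walk agrees almost surely with the original one, so `xInf` is unchanged.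
  obtain ⟨h', hc', hm', hi', hlaw', hae⟩ := exists_countable_range_modification hm hi hlaw
  have hW : ∀ n, Measurable (walk h' n) := fun n => measurable_walk hc' fun i _ => hm' i
  have hconv' : ∀ᵐ ω ∂P, ConvergesTo o (fun n => (walk h' n ω).1 o) (xInf ω) := by
    filter_upwards [hconv, hae] with ω h1 h2
    simpa only [h2] using h1
  have hxInf : AEMeasurable xInf P := aemeasurable_of_convergesTo hδ
    (fun n ρ => ((Measurable.of_discrete (f := fun g : G => ρ (g.1 o))).comp
      (hW n)).aemeasurable) hconv'
  have : IsProbabilityMeasure (P.map xInf) := Measure.isProbabilityMeasure_map hxInf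
  have hμ' := (hasFiniteFirstMoment_iff μ).1 hμ
  have key : ∀ C : ℝ, (∀ σ τ : GeodesicRay X, σ.Equivalent τ → ∀ x y : X,
      busemannRay σ x y ≤ busemannRay τ x y + C) →
      |rateOfEscape o μ - busemannDrift o μ (P.map xInf)| ≤ C := fun C hC =>
    abs_rateOfEscape_sub_busemannDrift_le hX hδ hC hμ hW (countable_range_walk hc')
      (measure_walk_preimage hc' hm' hi' hlaw') hxInf hconv'
  refine ⟨hxInf, exists_tendsto_firstMoment hμ',
    fun n => (hasFiniteFirstMoment_iff _).2 (eMoment_convPow_ne_top hμ' n),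
    fun g => integrable_busemann hX hδ _ _, summable_mul_integral_busemann hμ _,
    key _ fun σ τ hστ x y => hδ.busemannRay_le hστ x y, fun hP => ?_, fun hcat => hcat.propertyP⟩
  exact sub_eq_zero.1 (abs_nonpos_iff.1 (key 0 fun σ τ hστ x y => hP.busemannRay_le hστ x y))
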